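/- Let $d\ge 1$ and let $\mathcal D=\prod_{i=1}^d(a_i,b_i)\subset\mathbb R^d$ be a bounded open interval containing $[-1,1]^d$. For a function $g:\mathbb R^d\to\mathbb R$ and $0<\varepsilon<1$, one observes $\{X_\varepsilon(t),\ t\in\mathcal D\}$ in the Gaussian white noise model $$X_\varepsilon(dt)=g(t)\,dt+\varepsilon W(dt),\qquad t\in\mathcal D,$$ that is, $X_\varepsilon(t)=\int_0^{t_1}\!\cdots\int_0^{t_d} g(s)\,ds+\varepsilon W(t)$, where $W$ is the standard Brownian sheet on $\mathbb R^d$. Let $\mathbb E_g$ be the expectation with respect to the law of this observation, and let $\|h\|_\infty=\sup_{t\in[-1,1]^d}|h(t)|$. For $\alpha,L>0$ let $\lfloor\alpha\rfloor$ be the largest integer strictly less than $\alpha$, and let $\mathbb H_d(\alpha,L)$ be the set of all functions $G:\mathbb R^d\to\mathbb R$ that have all partial derivatives up to order $\lfloor\alpha\rfloor$ (continuous) and satisfy $$\sum_{0\le|k|\le\lfloor\alpha\rfloor}\ \sup_{x\in\mathbb R^d}|\partial^kG(x)|\le L,\qquad \Bigl|G(y)-\sum_{0\le|k|\le\lfloor\alpha\rfloor}\partial^kG(x)\prod_{j=1}^d\frac{(y_j-x_j)^{k_j}}{k_j!}\Bigr|\le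 L\|y-x\|^\alpha\quad\forall x,y\in\mathbb R^d,$$ where $\|\cdot\|$ is the Euclidean norm. For $\mathcal A=(\gamma,\beta)$ and $\mathcal L=(L_1,L_2)$ with $\gamma,\beta,L_1,L_2>0$, let $\mathbb H(\mathcal A,\mathcal L)$ be the class of all functions $g=f\circ G$ with $f\in\mathbb H_1(\gamma,L_1)$ and $G\in\mathbb H_d(\beta,L_2)$. Put $$\phi_\varepsilon(\gamma,\beta)=\begin{cases}(\varepsilon\sqrt{\ln(1/\varepsilon)})^{2\gamma/(2\gamma+1+(d-1)/\beta)}, & \beta>1,\ \beta\ge d(\gamma-1)+1,\\ (\varepsilon\sqrt{\ln(1/\varepsilon)})^{2/(2+d/\beta)}, & \gamma>1,\ \beta<d(\gamma-1)+1,\\ (\varepsilon\sqrt{\ln(1/\varepsilon)})^{2/(2+d/(\gamma\beta))}, & (\gamma,\beta)\in(0,1]^2.\end{cases}$$ **Theorem.** For all $\gamma,\beta,L_1,L_2>0$ and all $p>0$, $$\liminf_{\varepsilon\to0}\ \inf_{\tilde g_\varepsilon}\ \sup_{g\in\mathbb H(\mathcal A,\mathcal L)}\mathbb E_g\Bigl[\bigl(\phi_\varepsilon^{-1}(\gamma,\beta)\,\|\tilde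 g_\varepsilon-g\|_\infty\bigr)^p\Bigr]>0,$$ where $\inf_{\tilde g_\varepsilon}$ is the infimum over all estimators, i.e. over all functions $\tilde g_\varepsilon$ of the observation whose value at each point of $[-1,1]^d$ is a random variable. -/

import Mathlib

open MeasureTheory ProbabilityTheory Filter
open scoped Topology ENNReal

namespace CompositeEstimation

noncomputable section

/-- The largest integer strictly less than `α`, for `α > 0`. -/
def holderOrder (α : ℝ) : ℕ := ⌈α⌉₊ - 1

/-- The mixed partial derivative `∂^{|k|} G / ∂x₁^{k₁} ⋯ ∂x_d^{k_d}`. -/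
def mixedPartial {d : ℕ} (k : Fin d → ℕ) (G : EuclideanSpace ℝ (Fin d) → ℝ) :
    EuclideanSpace ℝ (Fin d) → ℝ :=
  (List.finRange d).foldr
    (fun i F => (fun H x => lineDeriv ℝ H x (EuclideanSpace.single i (1 : ℝ)))^[k i] F) G

/-- The isotropic Hölder class `ℍ_d(α, L)` of functions on `ℝ^d`. The multi-indices `k` with
`|k| ≤ holderOrder α` are grouped according to their length `n = |k|`; the suprema are taken
in `[0, ∞]`, so that the bound on their sum forces them to be finite. -/
structure IsHolder (d : ℕ) (α L : ℝ) (G : EuclideanSpace ℝ (Fin d) → ℝ) : Prop where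
  contDiff : ContDiff ℝ (holderOrder α) G
  bound : ∑ n ∈ Finset.range (holderOrder α + 1),
      ∑ k ∈ Finset.piAntidiag (Finset.univ : Finset (Fin d)) n,
        ⨆ x, ‖mixedPartial k G x‖ₑ ≤ ENNReal.ofReal L
  taylor : ∀ x y, |G y - ∑ n ∈ Finset.range (holderOrder α + 1),
      ∑ k ∈ Finset.piAntidiag (Finset.univ : Finset (Fin d)) n,
        mixedPartial k G x * ∏ j, (y j - x j) ^ k j / ((k j).factorial : ℝ)| ≤ L * ‖y - x‖ ^ α

/-- The Hölder class `ℍ_1(α, L)` of functions on `ℝ`. -/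
structure IsHolderReal (α L : ℝ) (f : ℝ → ℝ) : Prop where
  contDiff : ContDiff ℝ (holderOrder α) f
  bound : ∑ n ∈ Finset.range (holderOrder α + 1), ⨆ u, ‖iteratedDeriv n f u‖ₑ ≤ ENNReal.ofReal L
  taylor : ∀ u v, |f v - ∑ n ∈ Finset.range (holderOrder α + 1),
      iteratedDeriv n f u * ((v - u) ^ n / (n.factorial : ℝ))| ≤ L * |v - u| ^ α

/-- The class `ℍ(𝒜, ℒ)`, `𝒜 = (γ, β)`, `ℒ = (L₁, L₂)`, of the composite functions `f ∘ G` with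
`f ∈ ℍ_1(γ, L₁)` and `G ∈ ℍ_d(β, L₂)`. -/
def compositeClass (d : ℕ) (γ β L₁ L₂ : ℝ) : Set (EuclideanSpace ℝ (Fin d) → ℝ) :=
  {g | ∃ (f : ℝ → ℝ) (G : EuclideanSpace ℝ (Fin d) → ℝ),
    IsHolderReal γ L₁ f ∧ IsHolder d β L₂ G ∧ g = f ∘ G}

/-- The rate `φ_ε(γ, β)`. -/
def rate (d : ℕ) (γ β ε : ℝ) : ℝ :=
  if 1 < β ∧ d * (γ - 1) + 1 ≤ β then
    (ε * √(Real.log (1 / ε))) ^ (2 * γ / (2 * γ + 1 + (d - 1) / β))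
  else if 1 < γ ∧ β < d * (γ - 1) + 1 then
    (ε * √(Real.log (1 / ε))) ^ (2 / (2 + d / β))
  else -- the remaining case is `(γ, β) ∈ (0, 1]²`
    (ε * √(Real.log (1 / ε))) ^ (2 / (2 + d / (γ * β)))

/-- The open interval `∏ᵢ (aᵢ, bᵢ)` of `ℝ^d`. -/
def openBox {d : ℕ} (a b : Fin d → ℝ) : Set (EuclideanSpace ℝ (Fin d)) :=
  {t | ∀ i, t i ∈ Set.Ioo (a i) (b i)}

/-- The cube `[-1, 1]^d`. -/
def cube (d : ℕ) : Set (EuclideanSpace ℝ (Fin d)) :=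
  {t | ∀ i, t i ∈ Set.Icc (-1 : ℝ) 1}

/-- `W` is a standard Brownian sheet indexed by `ℝ^d` (all orthants): a centred Gaussian process
with almost surely continuous paths, whose covariance at `(s, t)` is the product over the
coordinates of the covariances of a two-sided standard Brownian motion vanishing at `0`. -/
structure IsBrownianSheet {d : ℕ} {Ω : Type*} [MeasurableSpace Ω]
    (W : EuclideanSpace ℝ (Fin d) → Ω → ℝ) (P : Measure Ω) : Prop where
  measurable : ∀ t, Measurable (W t)
  gaussian : IsGaussianProcess W P
  mean : ∀ t, ∫ ω, W t ω ∂P = 0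
  cov : ∀ s t, ∫ ω, W s ω * W t ω ∂P
    = ∏ i, if 0 ≤ s i * t i then min |s i| |t i| else 0
  continuous_paths : ∀ᵐ ω ∂P, Continuous fun t => W t ω

/-- The signed integral `∫₀^{t₁} ⋯ ∫₀^{t_d} g(s) ds`. -/
def cumulative {d : ℕ} (g : EuclideanSpace ℝ (Fin d) → ℝ) (t : EuclideanSpace ℝ (Fin d)) : ℝ :=
  (∏ i, Real.sign (t i)) * ∫ s in {s | ∀ i, s i ∈ Set.uIcc 0 (t i)}, g s

/-- The observation `{X_ε(t), t ∈ D}` of the white noise model `X_ε(dt) = g(t) dt + ε W(dt)` on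
`D`, in integrated form: `X_ε(t) = ∫₀^{t₁} ⋯ ∫₀^{t_d} g(s) ds + ε W(t)`. -/
def observation {d : ℕ} {Ω : Type*} (W : EuclideanSpace ℝ (Fin d) → Ω → ℝ)
    (D : Set (EuclideanSpace ℝ (Fin d))) (ε : ℝ) (g : EuclideanSpace ℝ (Fin d) → ℝ)
    (ω : Ω) : D → ℝ :=
  fun t => cumulative g t + ε * W t ω

/-- The law `ℙ_g` of the observation, on the product σ-algebra of `ℝ^D`. -/
def observationLaw {d : ℕ} {Ω : Type*} [MeasurableSpace Ω]
    (W : EuclideanSpace ℝ (Fin d) → Ω → ℝ) (P : Measure Ω)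
    (D : Set (EuclideanSpace ℝ (Fin d))) (ε : ℝ) (g : EuclideanSpace ℝ (Fin d) → ℝ) :
    Measure (D → ℝ) :=
  P.map (observation W D ε g)

/-- An estimator of `g` on `[-1, 1]^d` based on `{X_ε(t), t ∈ D}`: a function of the observation
whose value at every point of the cube is a random variable. -/
def IsEstimator {d : ℕ} (D : Set (EuclideanSpace ℝ (Fin d)))
    (T : (D → ℝ) → EuclideanSpace ℝ (Fin d) → ℝ) : Prop :=
  ∀ x ∈ cube d, Measurable fun X => T X x

/-- The sup-norm on `[-1, 1]^d`, with values in `[0, ∞]`. -/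
def supNorm {d : ℕ} (h : EuclideanSpace ℝ (Fin d) → ℝ) : ℝ≥0∞ :=
  ⨆ x ∈ cube d, ‖h x‖ₑ

/-- The minimax risk
`inf_T sup_{g ∈ 𝒢} 𝔼_g[(r⁻¹ ‖T - g‖_∞)^p]` over all estimators `T`, at noise level `ε`. -/
def minimaxSupRisk {d : ℕ} {Ω : Type*} [MeasurableSpace Ω]
    (W : EuclideanSpace ℝ (Fin d) → Ω → ℝ) (P : Measure Ω)
    (D : Set (EuclideanSpace ℝ (Fin d))) (𝒢 : Set (EuclideanSpace ℝ (Fin d) → ℝ))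
    (p r ε : ℝ) : ℝ≥0∞ :=
  ⨅ (T : (D → ℝ) → EuclideanSpace ℝ (Fin d) → ℝ) (_ : IsEstimator D T),
    ⨆ g ∈ 𝒢, ∫⁻ X, (ENNReal.ofReal r⁻¹ * supNorm (T X - g)) ^ p ∂(observationLaw W P D ε g)

end

end CompositeEstimation

/-! The risk is bounded below by testing many hypotheses against one reference. Take functions `g
j`, indexed by a grid of N points `x j`, such that `g j` differs from a reference `g₀` by at least
2s at `x j` and agrees with it at the other grid points. The events that the estimator is within s
of `g j` at every grid point are then disjoint, so one of them has probability at most 1/N under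
`g₀`. If the laws of the two observations are close enough, this event has probability at most 1/2
under `g j`, and an error of size s is made with probability at least 1/2 (`le_minimaxSupRisk`).

Closeness is measured by a Gaussian shift inequality. On the line, p_θ is a multiple of the
geometric mean of p_0 and p_{2θ}, so AM-GM bounds the shifted law by c/2 times the unshifted one
plus exp(θ²/v)/(2c). A finite Gaussian vector reduces to this case, since only one linear
combination of its coordinates feels the shift, and cylinder sets carry the bound to processes
(`map_process_add_inner_le`). For white noise the exponent is the squared L² distance of the drifts
divided by ε² (`observationLaw_le`). Since exp(V/ε²) ≤ N/4 suffices and N is a power of 1/δ, squared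
distances V of order ε² ln(1/ε) are allowed. With amplitude δ^a and V of order δ^v this yields the
exponent 2a/v (`liminf_minimaxSupRisk_pos`).

The rate thus depends on the choice of f ∘ G. Where β > 1, f is a comb of bumps of width about δ^β
and G a coordinate plus a bump of height about δ^β, which pushes the point off a tooth. The
difference has height δ^{γβ} and lives on a slab of volume δ^{β+d-1} (`exists_comb_hypotheses`).
Otherwise G is a bump of height δ^β on volume δ^d, and f is a sine, either at scale one (height δ^β)
or at scale δ^β (height δ^{γβ}) (`exists_bump_hypotheses`). Membership in the Hölder classes follows
from the scaling of derivatives. -/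

namespace CompositeEstimation

/-! ### Gaussian shift inequality, from the line to processes -/

section GaussianShift

open scoped RealInnerProductSpace NNReal

/-- Gaussian shift inequality on the line, from `p_θ² / p_0 = exp (θ² / v) p_{2θ}` and AM-GM. -/
lemma gaussianReal_le_smul_add_smul (θ : ℝ) {v : ℝ≥0} (hv : v ≠ 0) {c : ℝ} (hc : 0 < c) :
    gaussianReal θ v ≤ ENNReal.ofReal (c / 2) • gaussianReal 0 v
      + ENNReal.ofReal (Real.exp (θ ^ 2 / v) / (2 * c)) • gaussianReal (2 * θ) v := by
  have hv' : (0 : ℝ) < v := by positivity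
  rw [gaussianReal_of_var_ne_zero _ hv, gaussianReal_of_var_ne_zero _ hv,
    gaussianReal_of_var_ne_zero _ hv, ← withDensity_smul _ (measurable_gaussianPDF _ _),
    ← withDensity_smul _ (measurable_gaussianPDF _ _),
    ← withDensity_add_left ((measurable_gaussianPDF _ _).const_smul _)]
  refine withDensity_mono (Eventually.of_forall fun x => ?_)
  simp only [Pi.add_apply, Pi.smul_apply, smul_eq_mul, gaussianPDF]
  have h0 := gaussianPDFReal_nonneg 0 v x
  have h2 := gaussianPDFReal_nonneg (2 * θ) v x
  rw [← ENNReal.ofReal_mul (by positivity), ← ENNReal.ofReal_mul (by positivity),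
    ← ENNReal.ofReal_add (by positivity) (by positivity)]
  apply ENNReal.ofReal_le_ofReal
  have key : gaussianPDFReal θ v x ^ 2
      = Real.exp (θ ^ 2 / v) * gaussianPDFReal 0 v x * gaussianPDFReal (2 * θ) v x := by
    simp only [gaussianPDFReal]
    rw [mul_pow, ← Real.exp_nat_mul]
    have : ∀ a b c d : ℝ, Real.exp a * (b * Real.exp c) * (b * Real.exp d)
        = b ^ 2 * Real.exp (a + c + d) := by
      intro a b c d; rw [Real.exp_add, Real.exp_add]; ring
    rw [this]
    congr 2
    push_cast
    field_simp
    ring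
  have hsq : (gaussianPDFReal θ v x) ^ 2
      ≤ (c / 2 * gaussianPDFReal 0 v x
        + Real.exp (θ ^ 2 / v) / (2 * c) * gaussianPDFReal (2 * θ) v x) ^ 2 := by
    rw [key]
    have : Real.exp (θ ^ 2 / v) * gaussianPDFReal 0 v x * gaussianPDFReal (2 * θ) v x
        = 4 * (c / 2 * gaussianPDFReal 0 v x)
          * (Real.exp (θ ^ 2 / v) / (2 * c) * gaussianPDFReal (2 * θ) v x) := by
      field_simp; ring
    rw [this]
    nlinarith [sq_nonneg (c / 2 * gaussianPDFReal 0 v x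
      - Real.exp (θ ^ 2 / v) / (2 * c) * gaussianPDFReal (2 * θ) v x)]
  exact le_of_sq_le_sq hsq (by positivity)

variable {Ω : Type*} [MeasurableSpace Ω] {P : Measure Ω} [IsProbabilityMeasure P]
  {H : Type*} [NormedAddCommGroup H] [InnerProductSpace ℝ H]

/-- Orthogonal projection of h onto the span of the family. It replaces the shift by one coming from
a linear combination of the Gaussian coordinates, without increasing the norm. -/
lemma exists_sum_inner_eq_inner {ι : Type*} [Fintype ι] (v : ι → H) (h : H) :
    ∃ c : ι → ℝ, (∀ i, ⟪v i, ∑ k, c k • v k⟫ = ⟪v i, h⟫) ∧ ‖∑ k, c k • v k‖ ≤ ‖h‖ := by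
  let K := Submodule.span ℝ (Set.range v)
  have : FiniteDimensional ℝ K := FiniteDimensional.span_of_finite ℝ (Set.finite_range v)
  have hmem : (K.starProjection h) ∈ Submodule.span ℝ (Set.range v) :=
    Submodule.starProjection_apply_mem K h
  obtain ⟨c, hc⟩ := (Submodule.mem_span_range_iff_exists_fun ℝ).1 hmem
  refine ⟨c, fun i => ?_, ?_⟩
  · rw [hc]
    have hi : v i ∈ K := Submodule.subset_span ⟨i, rfl⟩
    have := K.starProjection_inner_eq_zero h (v i) hi
    rw [inner_sub_left, sub_eq_zero] at this
    rw [real_inner_comm, ← this, real_inner_comm]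
  · rw [hc]
    exact K.norm_starProjection_apply_le h

/-- Finite-dimensional shift inequality: translating a centred Gaussian vector with Gram matrix
`⟪v i, v j⟫` by `⟪v i, h⟫`. -/
lemma map_add_inner_le {ι : Type*} [Fintype ι] {X : ι → Ω → ℝ}
    (hXm : ∀ i, Measurable (X i))
    (hX : HasGaussianLaw (fun ω i => X i ω) P) (hmean : ∀ i, ∫ ω, X i ω ∂P = 0) {v : ι → H}
    (hcov : ∀ i j, ∫ ω, X i ω * X j ω ∂P = ⟪v i, v j⟫) (h : H) (q : ι → ℝ) {ε c : ℝ}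
    (hε : 0 < ε) (hc : 0 < c) {A : Set (ι → ℝ)} (hA : MeasurableSet A) :
    P.map (fun ω i => q i + ⟪v i, h⟫ + ε * X i ω) A
      ≤ ENNReal.ofReal (c / 2) * P.map (fun ω i => q i + ε * X i ω) A
        + ENNReal.ofReal (Real.exp (‖h‖ ^ 2 / ε ^ 2) / (2 * c)) := by
  obtain ⟨a, ha, hnorm⟩ := exists_sum_inner_eq_inner v h
  set u := ∑ k, a k • v k with hu
  have hLp : ∀ i, MemLp (X i) 2 P := fun i => (hX.eval i).memLp_two
  have hXX : ∀ i j, Integrable (fun ω => X i ω * X j ω) P :=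
    fun i j => (hLp i).integrable_mul (hLp j)
  let ξ : Ω → ℝ := fun ω => ∑ k, a k * X k ω
  have hξm : Measurable ξ := by fun_prop
  have hξLp : MemLp ξ 2 P := memLp_finsetSum _ fun k _ => (hLp k).const_mul _
  have hξX' : ∀ i, Integrable (fun ω => ξ ω * X i ω) P := fun i => hξLp.integrable_mul (hLp i)
  have hξξ' : Integrable (fun ω => ξ ω * ξ ω) P := hξLp.integrable_mul hξLp
  have hξmean : ∫ ω, ξ ω ∂P = 0 := by
    simp only [ξ]
    rw [integral_finsetSum _ fun k _ => ((hX.eval k).integrable.const_mul _)]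
    simp [integral_const_mul, hmean]
  have hξX : ∀ i, ∫ ω, ξ ω * X i ω ∂P = ⟪v i, u⟫ := by
    intro i
    have : ∀ ω, ξ ω * X i ω = ∑ k, a k * (X k ω * X i ω) := by
      intro ω; simp only [ξ, Finset.sum_mul, mul_assoc]
    simp only [this]
    rw [integral_finsetSum _ fun k _ => (hXX k i).const_mul _]
    simp only [integral_const_mul, hcov, hu, inner_sum, real_inner_smul_right]
    exact Finset.sum_congr rfl fun k _ => by rw [real_inner_comm]
  have hξξ : ∫ ω, ξ ω * ξ ω ∂P = ‖u‖ ^ 2 := by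
    have : ∀ ω, ξ ω * ξ ω = ∑ k, a k * (ξ ω * X k ω) := by
      intro ω
      conv_lhs => rw [show ξ ω * ξ ω = ξ ω * ∑ k, a k * X k ω from rfl]
      rw [Finset.mul_sum]; exact Finset.sum_congr rfl fun k _ => by ring
    simp only [this]
    rw [integral_finsetSum _ fun k _ => (hξX' k).const_mul _]
    simp only [integral_const_mul, hξX]
    rw [← real_inner_self_eq_norm_sq]
    conv_rhs => rw [hu, sum_inner]
    simp only [real_inner_smul_left]
    rw [← hu]
  have hexp : Real.exp (‖u‖ ^ 2 / ε ^ 2) ≤ Real.exp (‖h‖ ^ 2 / ε ^ 2) := by gcongr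
  -- Here ξ has variance zero and no density. There is no shift either, and c/2 + 1/(2c) ≥ 1 is
  -- enough.
  by_cases hu0 : u = 0
  · have hm : ∀ i, ⟪v i, h⟫ = 0 := fun i => by rw [← ha, hu0, inner_zero_right]
    simp only [hm, add_zero]
    have : IsProbabilityMeasure (P.map (fun ω i => q i + ε * X i ω)) :=
      Measure.isProbabilityMeasure_map (by fun_prop)
    set x := P.map (fun ω i => q i + ε * X i ω) A
    have hx : x ≤ 1 := prob_le_one
    have h1 : (1 : ℝ≥0∞) ≤ ENNReal.ofReal (c / 2) + ENNReal.ofReal (1 / (2 * c)) := by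
      rw [← ENNReal.ofReal_add (by positivity) (by positivity), ← ENNReal.ofReal_one]
      apply ENNReal.ofReal_le_ofReal
      have : c / 2 + 1 / (2 * c) = (c ^ 2 + 1) / (2 * c) := by field_simp
      rw [this, le_div_iff₀ (by positivity)]
      nlinarith [sq_nonneg (c - 1)]
    calc x = 1 * x := (one_mul x).symm
      _ ≤ (ENNReal.ofReal (c / 2) + ENNReal.ofReal (1 / (2 * c))) * x := by gcongr
      _ = ENNReal.ofReal (c / 2) * x + ENNReal.ofReal (1 / (2 * c)) * x := add_mul _ _ _
      _ ≤ ENNReal.ofReal (c / 2) * x + ENNReal.ofReal (1 / (2 * c)) * 1 := by gcongr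
      _ ≤ _ := by
        rw [mul_one]
        gcongr
        exact Real.one_le_exp (by positivity)
  have hσ : 0 < ‖u‖ ^ 2 := by positivity
  set s := ‖u‖ ^ 2 with hs
  -- Regression residual of X on ξ. It is uncorrelated with ξ, hence independent by joint
  -- Gaussianity. As the shift is s times the regression coefficients, it moves only the ξ
  -- component.
  let Y : ι → Ω → ℝ := fun i ω => X i ω - ξ ω * (⟪v i, u⟫ / s)
  have hYm : ∀ i, Measurable (Y i) := fun i => by fun_prop
  have hind : IndepFun ξ (fun ω i => Y i ω) P := by
    let L : (ι → ℝ) →L[ℝ] ℝ := ∑ k, a k • ContinuousLinearMap.proj k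
    let M : (ι → ℝ) →L[ℝ] ((Unit → ℝ) × (ι → ℝ)) :=
      (ContinuousLinearMap.pi fun _ => L).prod
        (ContinuousLinearMap.pi fun i => ContinuousLinearMap.proj i - (⟪v i, u⟫ / s) • L)
    have hG' : HasGaussianLaw (fun ω => ((fun _ : Unit => ξ ω), fun i => Y i ω)) P := by
      have hM : (fun ω => M fun i => X i ω) = fun ω => ((fun _ : Unit => ξ ω), fun i => Y i ω) := by
        funext ω
        refine Prod.ext (funext fun _ => ?_) (funext fun i => ?_)
        · simp [M, L, ξ]
        · simp [M, L, ξ, Y, mul_comm]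
      rw [← hM]
      exact hX.map_fun M
    have := HasGaussianLaw.indepFun_of_covariance_eval (X := fun _ : Unit => ξ) (Y := Y) hG' ?_
    · exact this.comp (φ := fun f : Unit → ℝ => f ()) (by fun_prop) measurable_id
    intro _ j
    have hYLp : MemLp (Y j) 2 P := (hLp j).sub (hξLp.mul_const _)
    rw [covariance_eq_sub hξLp hYLp, hξmean, zero_mul, sub_zero]
    have : ∀ ω, (ξ * Y j) ω = ξ ω * X j ω - ξ ω * ξ ω * (⟪v j, u⟫ / s) := by
      intro ω; simp only [Pi.mul_apply, Y]; ring
    simp only [this]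
    rw [integral_sub (hξX' j) (hξξ'.mul_const _), integral_mul_const, hξX, hξξ]
    field_simp
    ring
  have hlaw : P.map ξ = gaussianReal 0 s.toNNReal := by
    let L : (ι → ℝ) →L[ℝ] ℝ := ∑ k, a k • ContinuousLinearMap.proj k
    have hG : HasGaussianLaw ξ P := by
      have hL : (fun ω => L fun i => X i ω) = ξ := by
        funext ω; simp [L, ξ]
      rw [← hL]
      exact hX.map_fun L
    rw [hG.map_eq_gaussianReal, hξmean, variance_of_integral_eq_zero hξm.aemeasurable hξmean]
    simp only [pow_two, hξξ]
  let ρ := P.map (fun ω i => Y i ω)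
  have : IsProbabilityMeasure ρ := Measure.isProbabilityMeasure_map (by fun_prop)
  let w : ι → ℝ := fun i => ⟪v i, u⟫ / s
  let Φ : ℝ × (ι → ℝ) → ι → ℝ := fun z i => q i + z.1 * w i + ε * z.2 i
  have hΦ : Measurable Φ := by fun_prop
  have hvar : ε ^ 2 * s ≠ 0 := by positivity
  have hlaw' : ∀ b : ℝ, P.map (fun ω i => q i + b * w i + ε * X i ω)
      = ((gaussianReal b (ε ^ 2 * s).toNNReal).prod ρ).map Φ := by
    intro b
    have h1 : P.map (fun ω => ε * ξ ω + b) = gaussianReal b (ε ^ 2 * s).toNNReal := by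
      have : (fun ω => ε * ξ ω + b) = (fun x => x + b) ∘ (fun x => ε * x) ∘ ξ := rfl
      rw [this, ← Measure.map_map (by fun_prop) (by fun_prop), ← Measure.map_map (by fun_prop) hξm,
        hlaw, gaussianReal_map_const_mul, gaussianReal_map_add_const]
      congr 1
      · simp
      · ext
        simp [Real.coe_toNNReal _ hσ.le, Real.coe_toNNReal _ (by positivity : 0 ≤ ε ^ 2 * s)]
    have hind' : IndepFun (fun ω => ε * ξ ω + b) (fun ω i => Y i ω) P :=
      hind.comp (φ := fun x => ε * x + b) (by fun_prop) measurable_id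
    rw [← h1, ← (indepFun_iff_map_prod_eq_prod_map_map (by fun_prop) (by fun_prop)).1 hind',
      Measure.map_map hΦ (by fun_prop)]
    congr 1
    funext ω i
    simp only [Function.comp, Φ, Y, w]
    ring
  have hm : ∀ i, ⟪v i, h⟫ = s * w i := fun i => by
    rw [← ha]; simp only [w]; field_simp
  have e1 : (fun ω i => q i + ⟪v i, h⟫ + ε * X i ω) = fun ω i => q i + s * w i + ε * X i ω := by
    funext ω i; rw [hm]
  have e0 : (fun ω i => q i + ε * X i ω) = fun ω i => q i + 0 * w i + ε * X i ω := by
    funext ω i; ring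
  have hv0 : (ε ^ 2 * s).toNNReal ≠ 0 := by
    rw [Ne, Real.toNNReal_eq_zero, not_le]; positivity
  have hAΦ := hΦ hA
  rw [e1, e0, hlaw', hlaw', Measure.map_apply hΦ hA, Measure.map_apply hΦ hA,
    Measure.prod_apply_symm hAΦ, Measure.prod_apply_symm hAΦ]
  have hexp' : s ^ 2 / ((ε ^ 2 * s).toNNReal : ℝ) = s / ε ^ 2 := by
    rw [Real.coe_toNNReal _ (by positivity)]; field_simp
  have hbound := gaussianReal_le_smul_add_smul s hv0 hc
  rw [hexp'] at hbound
  -- Conditionally on Y this is the inequality on the line with shift s and variance ε² s, so its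
  -- exponent is s / ε². The law with the doubled shift is bounded by 1.
  calc ∫⁻ y, gaussianReal s (ε ^ 2 * s).toNNReal ((fun x => (x, y)) ⁻¹' (Φ ⁻¹' A)) ∂ρ
      ≤ ∫⁻ y, (ENNReal.ofReal (c / 2)
          * gaussianReal 0 (ε ^ 2 * s).toNNReal ((fun x => (x, y)) ⁻¹' (Φ ⁻¹' A))
          + ENNReal.ofReal (Real.exp (s / ε ^ 2) / (2 * c))) ∂ρ := by
        refine lintegral_mono fun y => (hbound _).trans ?_
        simp only [Measure.add_apply, Measure.smul_apply, smul_eq_mul]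
        gcongr
        exact mul_le_of_le_one_right' prob_le_one
    _ = ENNReal.ofReal (c / 2)
          * ∫⁻ y, gaussianReal 0 (ε ^ 2 * s).toNNReal ((fun x => (x, y)) ⁻¹' (Φ ⁻¹' A)) ∂ρ
          + ENNReal.ofReal (Real.exp (s / ε ^ 2) / (2 * c)) := by
        rw [lintegral_add_right _ measurable_const,
          lintegral_const_mul _ (measurable_measure_prodMk_right hAΦ)]
        simp
    _ ≤ _ := by gcongr

/-- The shift inequality for Gaussian processes, on the product σ-algebra. -/
theorem map_process_add_inner_le {T : Type*} {X : T → Ω → ℝ} (hXm : ∀ t, Measurable (X t))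
    (hX : IsGaussianProcess X P) (hmean : ∀ t, ∫ ω, X t ω ∂P = 0) {v : T → H}
    (hcov : ∀ s t, ∫ ω, X s ω * X t ω ∂P = ⟪v s, v t⟫) (h : H) (q : T → ℝ) {ε c : ℝ}
    (hε : 0 < ε) (hc : 0 < c) {A : Set (T → ℝ)} (hA : MeasurableSet A) :
    P.map (fun ω t => q t + ⟪v t, h⟫ + ε * X t ω) A
      ≤ ENNReal.ofReal (c / 2) * P.map (fun ω t => q t + ε * X t ω) A
        + ENNReal.ofReal (Real.exp (‖h‖ ^ 2 / ε ^ 2) / (2 * c)) := by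
  have hm1 : Measurable (fun ω t => q t + ⟪v t, h⟫ + ε * X t ω) :=
    measurable_pi_lambda _ fun t => by fun_prop
  have hm0 : Measurable (fun ω t => q t + ε * X t ω) :=
    measurable_pi_lambda _ fun t => by fun_prop
  have hcyl : ∀ B ∈ measurableCylinders (fun _ : T => ℝ),
      P.map (fun ω t => q t + ⟪v t, h⟫ + ε * X t ω) B
      ≤ ENNReal.ofReal (c / 2) * P.map (fun ω t => q t + ε * X t ω) B
        + ENNReal.ofReal (Real.exp (‖h‖ ^ 2 / ε ^ 2) / (2 * c)) := by
    intro B hB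
    obtain ⟨I, S, hS, rfl⟩ := (mem_measurableCylinders B).1 hB
    have hI := map_add_inner_le (X := fun i : I => X i) (fun i => hXm i) (hX.hasGaussianLaw I)
      (fun i => hmean i) (v := fun i : I => v i) (fun i j => hcov i j) h (fun i : I => q i) hε hc hS
    rw [Measure.map_apply (measurable_pi_lambda _ fun i => by fun_prop) hS,
      Measure.map_apply (measurable_pi_lambda _ fun i => by fun_prop) hS] at hI
    rw [Measure.map_apply hm1 (hS.cylinder I), Measure.map_apply hm0 (hS.cylinder I)]
    exact hI
  set μ := P.map (fun ω t => q t + ⟪v t, h⟫ + ε * X t ω)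
  set ν := P.map (fun ω t => q t + ε * X t ω)
  have : IsProbabilityMeasure μ := Measure.isProbabilityMeasure_map hm1.aemeasurable
  have : IsProbabilityMeasure ν := Measure.isProbabilityMeasure_map hm0.aemeasurable
  have hdense : (μ + ν).MeasureDense (measurableCylinders (fun _ : T => ℝ)) :=
    .of_generateFrom_isSetAlgebra_finite _ isSetAlgebra_measurableCylinders
      generateFrom_measurableCylinders.symm
  refine ENNReal.le_of_forall_pos_le_add fun η hη _ => ?_
  set k := ENNReal.ofReal (c / 2) with hk
  -- The approximation error enters once through μ and c/2 times through ν. Approximating for the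
  -- sum μ + ν controls both with a single cylinder.
  have hη' : 0 < (η : ℝ) / (1 + c / 2) := by positivity
  obtain ⟨B, hB, hAB⟩ := hdense.approx A hA (measure_ne_top _ _) _ hη'
  have hsub1 : μ A ≤ μ B + μ (symmDiff A B) :=
    (measure_mono fun x hx => by
      by_cases hxB : x ∈ B
      exacts [Or.inl hxB, Or.inr (Or.inl ⟨hx, hxB⟩)]).trans (measure_union_le _ _)
  have hsub2 : ν B ≤ ν A + ν (symmDiff A B) :=
    (measure_mono fun x hx => by
      by_cases hxA : x ∈ A
      exacts [Or.inl hxA, Or.inr (Or.inr ⟨hx, hxA⟩)]).trans (measure_union_le _ _)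
  have hμd : μ (symmDiff A B) ≤ ENNReal.ofReal ((η : ℝ) / (1 + c / 2)) :=
    (Measure.le_iff'.1 (Measure.le_add_right le_rfl) _).trans hAB.le
  have hνd : ν (symmDiff A B) ≤ ENNReal.ofReal ((η : ℝ) / (1 + c / 2)) :=
    (Measure.le_iff'.1 (Measure.le_add_left le_rfl) _).trans hAB.le
  calc μ A ≤ (k * ν B + ENNReal.ofReal (Real.exp (‖h‖ ^ 2 / ε ^ 2) / (2 * c)))
        + ENNReal.ofReal ((η : ℝ) / (1 + c / 2)) := hsub1.trans (add_le_add (hcyl B hB) hμd)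
    _ ≤ (k * (ν A + ENNReal.ofReal ((η : ℝ) / (1 + c / 2)))
        + ENNReal.ofReal (Real.exp (‖h‖ ^ 2 / ε ^ 2) / (2 * c)))
        + ENNReal.ofReal ((η : ℝ) / (1 + c / 2)) := by
      gcongr; exact hsub2.trans (by gcongr)
    _ = k * ν A + ENNReal.ofReal (Real.exp (‖h‖ ^ 2 / ε ^ 2) / (2 * c))
        + (1 + k) * ENNReal.ofReal ((η : ℝ) / (1 + c / 2)) := by ring
    _ ≤ _ := by
      gcongr
      rw [hk, ← ENNReal.ofReal_one, ← ENNReal.ofReal_add zero_le_one (by positivity),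
        ← ENNReal.ofReal_mul (by positivity), mul_div_cancel₀ _ (by positivity)]
      simp

end GaussianShift

end CompositeEstimation

namespace CompositeEstimation

/-! ### White noise as a Gaussian process indexed by L² -/

section WhiteNoise

open scoped RealInnerProductSpace

variable {d : ℕ}

/-- The closed box spanned by `0` and `t`. -/
def originBox (t : EuclideanSpace ℝ (Fin d)) : Set (EuclideanSpace ℝ (Fin d)) :=
  {s | ∀ i, s i ∈ Set.uIcc 0 (t i)}

/-- A product set, seen in Euclidean space. -/
lemma setOf_forall_eq_preimage (S : Fin d → Set ℝ) :
    {s : EuclideanSpace ℝ (Fin d) | ∀ i, s i ∈ S i}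
      = (WithLp.ofLp : EuclideanSpace ℝ (Fin d) → Fin d → ℝ) ⁻¹' Set.univ.pi S := by
  ext; simp

lemma volume_setOf_forall {S : Fin d → Set ℝ} (hS : ∀ i, MeasurableSet (S i)) :
    volume {s : EuclideanSpace ℝ (Fin d) | ∀ i, s i ∈ S i} = ∏ i, volume (S i) := by
  rw [setOf_forall_eq_preimage,
    (PiLp.volume_preserving_ofLp (Fin d)).measure_preimage
      (MeasurableSet.univ_pi hS).nullMeasurableSet, volume_pi_pi]

lemma isCompact_originBox (t : EuclideanSpace ℝ (Fin d)) : IsCompact (originBox t) := by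
  have : originBox t = (EuclideanSpace.equiv (Fin d) ℝ) ⁻¹'
      Set.univ.pi fun i => Set.uIcc 0 (t i) := by
    ext x
    simp only [originBox, Set.mem_ofPred_eq, Set.mem_preimage, Set.mem_univ_pi]
    rfl
  rw [this]
  exact (EuclideanSpace.equiv (Fin d) ℝ).toHomeomorph.isCompact_preimage.2
    (isCompact_univ_pi fun i => isCompact_uIcc)

lemma measurableSet_originBox (t : EuclideanSpace ℝ (Fin d)) : MeasurableSet (originBox t) :=
  (isCompact_originBox t).measurableSet

lemma volume_originBox_ne_top (t : EuclideanSpace ℝ (Fin d)) : volume (originBox t) ≠ ∞ :=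
  (isCompact_originBox t).measure_lt_top.ne

/-- The signed indicator of the box spanned by `0` and `t`, in `L²(ℝ^d)`. -/
noncomputable def signedIndicator (t : EuclideanSpace ℝ (Fin d)) :
    Lp ℝ 2 (volume : Measure (EuclideanSpace ℝ (Fin d))) :=
  (∏ i, Real.sign (t i)) •
    indicatorConstLp 2 (measurableSet_originBox t) (volume_originBox_ne_top t) (1 : ℝ)

/-- One coordinate of the sheet covariance. For opposite signs the intervals meet only at 0, and for
s = 0 or t = 0 both sides vanish because the sign of 0 is 0. -/
lemma sign_mul_volume_uIcc_inter (s t : ℝ) :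
    Real.sign s * Real.sign t * volume.real (Set.uIcc 0 s ∩ Set.uIcc 0 t)
      = if 0 ≤ s * t then min |s| |t| else 0 := by
  rcases lt_trichotomy s 0 with hs | rfl | hs
  · rcases lt_trichotomy t 0 with ht | rfl | ht
    · rw [Set.uIcc_of_ge hs.le, Set.uIcc_of_ge ht.le, Set.Icc_inter_Icc, if_pos (by nlinarith),
        Real.sign_of_neg hs, Real.sign_of_neg ht, Real.volume_real_Icc, abs_of_neg hs,
        abs_of_neg ht, min_self, max_eq_left (by simp [hs.le, ht.le])]
      rw [min_neg_neg]; ring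
    · simp
    · rw [if_neg (by nlinarith), Set.uIcc_of_ge hs.le, Set.uIcc_of_le ht.le, Set.Icc_inter_Icc,
        Real.volume_real_Icc]
      simp [hs.le, ht.le]
  · simp
  · rcases lt_trichotomy t 0 with ht | rfl | ht
    · rw [if_neg (by nlinarith), Set.uIcc_of_ge ht.le, Set.uIcc_of_le hs.le, Set.Icc_inter_Icc,
        Real.volume_real_Icc]
      simp [hs.le, ht.le]
    · simp
    · rw [Set.uIcc_of_le hs.le, Set.uIcc_of_le ht.le, Set.Icc_inter_Icc, if_pos (by nlinarith),
        Real.sign_of_pos hs, Real.sign_of_pos ht, Real.volume_real_Icc, abs_of_pos hs,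
        abs_of_pos ht, max_self, sub_zero, max_eq_left (by simp [hs.le, ht.le])]
      ring

/-- Signed indicators have the covariance of the Brownian sheet as their Gram matrix, which is what
the shift inequality asks for. -/
lemma inner_signedIndicator_signedIndicator (s t : EuclideanSpace ℝ (Fin d)) :
    ⟪signedIndicator s, signedIndicator t⟫
      = ∏ i, if 0 ≤ s i * t i then min |s i| |t i| else 0 := by
  have hvol : volume.real (originBox s ∩ originBox t)
      = ∏ i, volume.real (Set.uIcc 0 (s i) ∩ Set.uIcc 0 (t i)) := by
    have : originBox s ∩ originBox t = {x : EuclideanSpace ℝ (Fin d) |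
        ∀ i, x i ∈ Set.uIcc 0 (s i) ∩ Set.uIcc 0 (t i)} := by
      ext x
      simp only [originBox, Set.mem_inter_iff, Set.mem_ofPred_eq, forall_and]
    rw [measureReal_def, this, volume_setOf_forall fun i => measurableSet_uIcc.inter measurableSet_uIcc,
      ENNReal.toReal_prod]
    rfl
  rw [signedIndicator, signedIndicator, real_inner_smul_left, real_inner_smul_right,
    L2.real_inner_indicatorConstLp_one_indicatorConstLp_one (measurableSet_originBox s)
      (measurableSet_originBox t) (volume_originBox_ne_top s) (volume_originBox_ne_top t), hvol, ← mul_assoc,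
    ← Finset.prod_mul_distrib, ← Finset.prod_mul_distrib]
  exact Finset.prod_congr rfl fun i _ => sign_mul_volume_uIcc_inter _ _

/-- Identifies the drift of the observation as a shift in the direction h of L². -/
lemma inner_signedIndicator {h : EuclideanSpace ℝ (Fin d) → ℝ} (hh : MemLp h 2 volume)
    (t : EuclideanSpace ℝ (Fin d)) :
    ⟪signedIndicator t, hh.toLp h⟫ = cumulative h t := by
  rw [signedIndicator, real_inner_smul_left,
    L2.inner_indicatorConstLp_one (𝕜 := ℝ) (measurableSet_originBox t) (volume_originBox_ne_top t),
    cumulative]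
  congr 1
  exact setIntegral_congr_ae (measurableSet_originBox t) (hh.coeFn_toLp.mono fun _ hx _ => hx)

lemma cumulative_add {g h : EuclideanSpace ℝ (Fin d) → ℝ} (hg : Continuous g) (hh : Continuous h)
    (t : EuclideanSpace ℝ (Fin d)) :
    cumulative (g + h) t = cumulative g t + cumulative h t := by
  have hb : {s : EuclideanSpace ℝ (Fin d) | ∀ i, s i ∈ Set.uIcc 0 (t i)} = originBox t := rfl
  simp only [cumulative, hb, Pi.add_apply]
  rw [integral_add (hg.continuousOn.integrableOn_compact (isCompact_originBox t))
    (hh.continuousOn.integrableOn_compact (isCompact_originBox t)), mul_add]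

variable {Ω : Type*} [MeasurableSpace Ω] {P : Measure Ω}
  {W : EuclideanSpace ℝ (Fin d) → Ω → ℝ}

lemma measurable_observation (hW : IsBrownianSheet W P) (D : Set (EuclideanSpace ℝ (Fin d)))
    (ε : ℝ) (g : EuclideanSpace ℝ (Fin d) → ℝ) : Measurable (observation W D ε g) := by
  have := hW.measurable
  exact measurable_pi_lambda _ fun t => by unfold observation; fun_prop

lemma isProbabilityMeasure_observationLaw [IsProbabilityMeasure P] (hW : IsBrownianSheet W P)
    (D : Set (EuclideanSpace ℝ (Fin d))) (ε : ℝ) (g : EuclideanSpace ℝ (Fin d) → ℝ) :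
    IsProbabilityMeasure (observationLaw W P D ε g) :=
  Measure.isProbabilityMeasure_map (measurable_observation hW D ε g).aemeasurable

/-- Comparison of two white noise experiments through the `L²` distance of their drifts. -/
theorem observationLaw_le [IsProbabilityMeasure P] (hW : IsBrownianSheet W P)
    (D : Set (EuclideanSpace ℝ (Fin d))) {g₀ g₁ : EuclideanSpace ℝ (Fin d) → ℝ} (hg₀ : Continuous g₀) (hg₁ : Continuous g₁)
    (hL2 : MemLp (g₁ - g₀) 2 volume) {ε c : ℝ} (hε : 0 < ε) (hc : 0 < c)
    {A : Set (D → ℝ)} (hA : MeasurableSet A) :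
    observationLaw W P D ε g₁ A ≤ ENNReal.ofReal (c / 2) * observationLaw W P D ε g₀ A
      + ENNReal.ofReal (Real.exp ((∫ x, (g₁ x - g₀ x) ^ 2) / ε ^ 2) / (2 * c)) := by
  have hnorm : ‖hL2.toLp (g₁ - g₀)‖ ^ 2 = ∫ x, (g₁ x - g₀ x) ^ 2 := by
    rw [← real_inner_self_eq_norm_sq, L2.inner_def]
    refine integral_congr_ae (hL2.coeFn_toLp.mono fun x hx => ?_)
    simp only [hx, RCLike.inner_apply, conj_trivial, Pi.sub_apply, pow_two]
  have key := map_process_add_inner_le (P := P) (X := fun (t : D) ω => W t ω)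
    (fun t => hW.measurable t) (hW.gaussian.comp_right (fun t : D => (t : EuclideanSpace ℝ (Fin d))))
    (fun t => hW.mean t) (v := fun t : D => signedIndicator (t : EuclideanSpace ℝ (Fin d)))
    (fun s t => by rw [inner_signedIndicator_signedIndicator]; exact hW.cov s t)
    (hL2.toLp (g₁ - g₀)) (fun t => cumulative g₀ t) hε hc hA
  rw [hnorm] at key
  have e : observation W D ε g₁ = fun ω (t : D) => cumulative g₀ t
      + ⟪signedIndicator (t : EuclideanSpace ℝ (Fin d)), hL2.toLp (g₁ - g₀)⟫ + ε * W t ω := by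
    funext ω t
    rw [inner_signedIndicator, ← cumulative_add hg₀ (hg₁.sub hg₀), add_sub_cancel]
    rfl
  rw [observationLaw, observationLaw, e]
  exact key

end WhiteNoise

end CompositeEstimation

namespace CompositeEstimation

/-! ### Reduction of the minimax risk to finitely many hypotheses -/

section LowerBound

variable {d : ℕ} {Ω : Type*} [MeasurableSpace Ω] {P : Measure Ω} [IsProbabilityMeasure P]
  {W : EuclideanSpace ℝ (Fin d) → Ω → ℝ}

/-- Minimax lower bound from finitely many hypotheses `g j`, each differing from the reference `g₀`
at a point of its own. -/
theorem le_minimaxSupRisk (hW : IsBrownianSheet W P) (D : Set (EuclideanSpace ℝ (Fin d)))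
    {𝒢 : Set (EuclideanSpace ℝ (Fin d) → ℝ)} {p r ε s V : ℝ} (hp : 0 < p) (hr : 0 < r)
    (hε : 0 < ε) (hs : 0 < s) {ι : Type*} [Fintype ι] [Nonempty ι]
    {g₀ : EuclideanSpace ℝ (Fin d) → ℝ} {g : ι → EuclideanSpace ℝ (Fin d) → ℝ}
    {x : ι → EuclideanSpace ℝ (Fin d)} (hg₀ : Continuous g₀) (hg : ∀ j, Continuous (g j))
    (hmem : ∀ j, g j ∈ 𝒢) (hx : ∀ j, x j ∈ cube d)
    (hsep : ∀ j, 2 * s ≤ |g j (x j) - g₀ (x j)|)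
    (heq : ∀ i j, i ≠ j → g i (x j) = g₀ (x j))
    (hL2 : ∀ j, MemLp (g j - g₀) 2 volume) (hV : ∀ j, ∫ y, (g j y - g₀ y) ^ 2 ≤ V)
    (hcard : Real.exp (V / ε ^ 2) ≤ Fintype.card ι / 4) :
    ENNReal.ofReal ((s / r) ^ p / 2) ≤ minimaxSupRisk W P D 𝒢 p r ε := by
  refine le_iInf₂ fun T hT => ?_
  have hTm : ∀ j, Measurable fun X => T X (x j) := fun j => hT (x j) (hx j)
  -- Only the finitely many grid points are inspected, so pointwise measurability of the estimator
  -- suffices.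
  let B : ι → Set (D → ℝ) := fun j => {X | ∀ i, |T X (x i) - g j (x i)| < s}
  have hB : ∀ j, MeasurableSet (B j) := fun j => by
    have : B j = ⋂ i, {X | |T X (x i) - g j (x i)| < s} := by ext; simp [B]
    rw [this]
    refine MeasurableSet.iInter fun i => ?_
    have hi := hTm i
    exact measurableSet_lt (f := fun X => |T X (x i) - g j (x i)|) (by fun_prop) measurable_const
  have hdisj : Pairwise (Function.onFun Disjoint B) := by
    intro i j hij
    refine Set.disjoint_left.2 fun X hi hj => ?_
    have h1 := abs_lt.1 (hi j)
    have h2 := abs_lt.1 (hj j)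
    have h3 := hsep j
    rw [heq i j hij] at h1
    rcases abs_cases (g j (x j) - g₀ (x j)) with h | h <;> linarith [h1.1, h1.2, h2.1, h2.2]
  set N : ℝ := (Fintype.card ι : ℝ) with hN
  have hNpos : 0 < N := by positivity
  have := isProbabilityMeasure_observationLaw hW D ε g₀
  obtain ⟨j, hj⟩ : ∃ j, observationLaw W P D ε g₀ (B j) ≤ ENNReal.ofReal (1 / N) := by
    by_contra! hcon
    have h1 : ∑ j, (observationLaw W P D ε g₀).real (B j) ≤ 1 := by
      rw [← measureReal_iUnion_fintype hdisj hB]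
      exact measureReal_le_one
    have h2 : ∑ _j : ι, 1 / N < ∑ j, (observationLaw W P D ε g₀).real (B j) := by
      refine Finset.sum_lt_sum_of_nonempty Finset.univ_nonempty fun j _ => ?_
      exact (ENNReal.ofReal_lt_iff_lt_toReal (by positivity) (measure_ne_top _ _)).1 (hcon j)
    rw [Finset.sum_const, Finset.card_univ, nsmul_eq_mul, ← hN, mul_one_div_cancel hNpos.ne'] at h2
    linarith
  have := isProbabilityMeasure_observationLaw hW D ε (g j)
  have hBj : observationLaw W P D ε (g j) (B j) ≤ ENNReal.ofReal (1 / 2) := by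
    -- The choice c = N/2 makes both terms at most 1/4: N/4 · 1/N, and exp(V/ε²)/N.
    refine (observationLaw_le hW D hg₀ (hg j) (hL2 j) hε (half_pos hNpos) (hB j)).trans ?_
    calc _ ≤ ENNReal.ofReal (N / 2 / 2) * ENNReal.ofReal (1 / N) + ENNReal.ofReal (1 / 4) := by
          refine add_le_add (by gcongr) (ENNReal.ofReal_le_ofReal ?_)
          have h1 : Real.exp ((∫ y, (g j y - g₀ y) ^ 2) / ε ^ 2) ≤ N / 4 := by
            refine le_trans ?_ hcard
            gcongr
            exact hV j
          rw [div_le_iff₀ (by positivity)]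
          linarith
      _ = ENNReal.ofReal (1 / 2) := by
          rw [← ENNReal.ofReal_mul (by positivity), ← ENNReal.ofReal_add (by positivity) (by norm_num)]
          congr 1
          field_simp
          norm_num
  have hBc : ENNReal.ofReal (1 / 2) ≤ observationLaw W P D ε (g j) (B j)ᶜ := by
    rw [prob_compl_eq_one_sub (hB j)]
    refine le_trans ?_ (tsub_le_tsub_left hBj 1)
    rw [← ENNReal.ofReal_one, ← ENNReal.ofReal_sub _ (by norm_num)]
    norm_num
  refine le_trans ?_ (le_iSup₂ (f := fun g (_ : g ∈ 𝒢) => ∫⁻ X, (ENNReal.ofReal r⁻¹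
    * supNorm (T X - g)) ^ p ∂(observationLaw W P D ε g)) (g j) (hmem j))
  calc ENNReal.ofReal ((s / r) ^ p / 2)
      = ENNReal.ofReal (s / r) ^ p * ENNReal.ofReal (1 / 2) := by
        rw [ENNReal.ofReal_rpow_of_nonneg (by positivity) hp.le, ← ENNReal.ofReal_mul (by positivity)]
        congr 1; ring
    _ ≤ ENNReal.ofReal (s / r) ^ p * observationLaw W P D ε (g j) (B j)ᶜ := by gcongr
    _ = ∫⁻ _ in (B j)ᶜ, ENNReal.ofReal (s / r) ^ p ∂(observationLaw W P D ε (g j)) := by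
        rw [setLIntegral_const]
    -- Monotonicity of the lower integral does not require the sup norm of the error to be
    -- measurable.
    _ ≤ ∫⁻ X in (B j)ᶜ, (ENNReal.ofReal r⁻¹ * supNorm (T X - g j)) ^ p
          ∂(observationLaw W P D ε (g j)) := by
        refine setLIntegral_mono' (hB j).compl fun X hX => ?_
        gcongr
        simp only [B, Set.mem_compl_iff, Set.mem_ofPred_eq, not_forall, not_lt] at hX
        obtain ⟨i, hi⟩ := hX
        rw [div_eq_inv_mul, ENNReal.ofReal_mul (by positivity)]
        gcongr
        refine le_trans ?_ (le_iSup₂ (f := fun y (_ : y ∈ cube d) => ‖(T X - g j) y‖ₑ) (x i) (hx i))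
        rw [Real.enorm_eq_ofReal_abs]
        exact ENNReal.ofReal_le_ofReal hi
    _ ≤ _ := setLIntegral_le_lintegral _ _

/-- Hypotheses indexed by a grid of mesh `π δ`, of amplitude `δ ^ a` and squared `L²` size `δ ^ v`,
lead to the rate `(ε √(log (1 / ε))) ^ (2 a / v)`. -/
theorem liminf_minimaxSupRisk_pos (hd : 1 ≤ d) (hW : IsBrownianSheet W P)
    (D : Set (EuclideanSpace ℝ (Fin d))) {𝒢 : Set (EuclideanSpace ℝ (Fin d) → ℝ)}
    {p a v κ C δ₀ : ℝ} (hp : 0 < p) (hv : 0 < v) (hκ : 0 < κ) (hC : 0 < C)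
    (hδ₀ : 0 < δ₀) {r : ℝ → ℝ}
    (hr : ∀ ε, r ε = (ε * √(Real.log (1 / ε))) ^ (2 * a / v))
    (hyp : ∀ δ : ℝ, 0 < δ → δ ≤ δ₀ → ∀ M : ℕ, Real.pi * δ * M ≤ 1 →
      ∃ (g₀ : EuclideanSpace ℝ (Fin d) → ℝ)
        (g : (Fin d → Fin M) → EuclideanSpace ℝ (Fin d) → ℝ)
        (x : (Fin d → Fin M) → EuclideanSpace ℝ (Fin d)),
        Continuous g₀ ∧ ∀ j, Continuous (g j) ∧ g j ∈ 𝒢 ∧ x j ∈ cube d ∧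
          2 * (κ * δ ^ a) ≤ |g j (x j) - g₀ (x j)| ∧ (∀ i, i ≠ j → g i (x j) = g₀ (x j)) ∧
          MemLp (g j - g₀) 2 volume ∧ ∫ y, (g j y - g₀ y) ^ 2 ≤ C * δ ^ v) :
    0 < liminf (fun ε => minimaxSupRisk W P D 𝒢 p (r ε) ε) (𝓝[>] (0 : ℝ)) := by
  -- Below, δ^v = k ε² ln(1/ε). The bound on C k makes exp(C δ^v / ε²) at most Z = ε^{-1/(2v)}.
  obtain ⟨k, hk0, hk1, hkC⟩ : ∃ k : ℝ, 0 < k ∧ k ≤ 1 ∧ C * k ≤ 1 / (2 * v) :=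
    ⟨min 1 (1 / (2 * v * C)), by positivity, min_le_left _ _, by
      calc C * min 1 (1 / (2 * v * C)) ≤ C * (1 / (2 * v * C)) := by gcongr; exact min_le_right _ _
        _ = 1 / (2 * v) := by field_simp⟩
  have hconst : 0 < (κ * k ^ (a / v)) ^ p / 2 := by positivity
  refine lt_of_lt_of_le (ENNReal.ofReal_pos.2 hconst) (le_liminf_of_le (by isBoundedDefault) ?_)
  have hZ : Tendsto (fun ε : ℝ => (1 / ε) ^ (1 / (2 * v))) (𝓝[>] 0) atTop := by
    simp only [one_div]
    exact (tendsto_rpow_atTop (by positivity)).comp tendsto_inv_nhdsGT_zero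
  have hlt1 : ∀ᶠ ε : ℝ in 𝓝[>] 0, ε < 1 := nhdsWithin_le_nhds (Iio_mem_nhds one_pos)
  filter_upwards [hZ.eventually_ge_atTop (8 * Real.pi), hZ.eventually_ge_atTop (1 / δ₀), hlt1,
    self_mem_nhdsWithin] with ε hε8 hεδ hε1 hε0
  have hε0 : 0 < ε := hε0
  set Z := (1 / ε) ^ (1 / (2 * v)) with hZdef
  have hπ := Real.pi_gt_three
  have hZ1 : 1 ≤ Z := by linarith
  set ℓ := Real.log (1 / ε) with hℓ
  have hℓ0 : 0 < ℓ := Real.log_pos (by rw [lt_div_iff₀ hε0]; linarith)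
  have hℓ1 : ℓ ≤ 1 / ε := (Real.log_le_sub_one_of_pos (by positivity)).trans (by linarith)
  set y := k * (ε ^ 2 * ℓ) with hy
  have hy0 : 0 < y := by positivity
  set δ := y ^ (1 / v) with hδ
  have hδpos : 0 < δ := by positivity
  have hδv : δ ^ v = y := by rw [hδ, ← Real.rpow_mul hy0.le, one_div_mul_cancel hv.ne', Real.rpow_one]
  have hyε : y ≤ ε := by
    calc y ≤ 1 * (ε ^ 2 * (1 / ε)) := by rw [hy]; gcongr
      _ = ε := by field_simp
  -- From ln(1/ε) ≤ 1/ε. So the grid has at least Z²/(2π) points per axis, which exceeds 4Z once Z ≥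
  -- 8π.
  have hδZ : δ ≤ 1 / Z ^ 2 := by
    calc δ ≤ ε ^ (1 / v) := by rw [hδ]; gcongr
      _ = 1 / Z ^ 2 := by
        rw [hZdef, ← Real.rpow_natCast, ← Real.rpow_mul (by positivity), one_div ε,
          Real.inv_rpow hε0.le, one_div (_ ⁻¹), inv_inv]
        congr 1; field_simp; norm_num
  have hδZ' : δ ≤ 1 / Z := hδZ.trans (by
    apply one_div_le_one_div_of_le (by positivity); nlinarith)
  have hδδ₀ : δ ≤ δ₀ := by
    refine hδZ'.trans ?_
    rw [div_le_iff₀ hδ₀] at hεδ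
    rw [div_le_iff₀ (by positivity)]; linarith
  have hδπ : 2 * Real.pi * δ ≤ 1 := by
    have : δ * Z ≤ 1 := by rwa [le_div_iff₀ (by positivity)] at hδZ'
    nlinarith
  set M := ⌊1 / (Real.pi * δ)⌋₊ with hM
  have hMle : (M : ℝ) ≤ 1 / (Real.pi * δ) := Nat.floor_le (by positivity)
  have hMge : 1 / (2 * Real.pi * δ) ≤ M := by
    have h1 : 1 / (Real.pi * δ) < M + 1 := Nat.lt_floor_add_one _
    have h2 : 1 ≤ 1 / (2 * Real.pi * δ) := by rw [le_div_iff₀ (by positivity)]; linarith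
    have h3 : 1 / (Real.pi * δ) = 2 * (1 / (2 * Real.pi * δ)) := by field_simp
    linarith
  have hMpos : 0 < M := by
    have : (0 : ℝ) < M := lt_of_lt_of_le (by positivity) hMge
    exact_mod_cast this
  have hπM : Real.pi * δ * M ≤ 1 := by
    rw [le_div_iff₀ (by positivity)] at hMle; linarith
  obtain ⟨g₀, g, x, hg₀, hg⟩ := hyp δ hδpos hδδ₀ M hπM
  have : Nonempty (Fin d → Fin M) := ⟨fun _ => ⟨0, hMpos⟩⟩
  have hδa : δ ^ a = k ^ (a / v) * r ε := by
    rw [hr, hδ, ← Real.rpow_mul hy0.le, hy, Real.mul_rpow hk0.le (by positivity),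
      one_div_mul_eq_div]
    congr 1
    have : ε ^ 2 * ℓ = (ε * √ℓ) ^ (2 : ℝ) := by
      rw [Real.rpow_two, mul_pow, Real.sq_sqrt hℓ0.le]
    rw [this, ← Real.rpow_mul (by positivity)]
    congr 1; ring
  have hrpos : 0 < r ε := by rw [hr]; positivity
  have hmain := le_minimaxSupRisk hW D (𝒢 := 𝒢) (s := κ * δ ^ a) (V := C * δ ^ v) hp hrpos hε0
    (by positivity) hg₀ (fun j => (hg j).1) (fun j => (hg j).2.1) (fun j => (hg j).2.2.1)
    (fun j => (hg j).2.2.2.1) (fun i j hij => (hg j).2.2.2.2.1 i hij)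
    (fun j => (hg j).2.2.2.2.2.1) (fun j => (hg j).2.2.2.2.2.2) ?_
  · have e : κ * δ ^ a / r ε = κ * k ^ (a / v) := by rw [hδa]; field_simp
    rwa [e] at hmain
  · have h1 : C * δ ^ v / ε ^ 2 ≤ ℓ * (1 / (2 * v)) := by
      rw [hδv, hy]
      calc C * (k * (ε ^ 2 * ℓ)) / ε ^ 2 = ℓ * (C * k) := by field_simp
        _ ≤ _ := by gcongr
    have h2 : Real.exp (ℓ * (1 / (2 * v))) = Z := by
      rw [hZdef, Real.rpow_def_of_pos (by positivity)]
    -- Counting a single axis is enough: the number of hypotheses only needs to be a positive power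
    -- of 1/δ.
    have h3 : (M : ℝ) ≤ Fintype.card (Fin d → Fin M) := by
      rw [Fintype.card_fun, Fintype.card_fin, Fintype.card_fin]
      exact_mod_cast Nat.le_self_pow (by omega) M
    have h4 : Z ^ 2 / (2 * Real.pi) ≤ M := by
      refine le_trans ?_ hMge
      rw [le_div_iff₀ (by positivity)] at hδZ
      rw [div_le_div_iff₀ (by positivity) (by positivity)]
      nlinarith
    calc Real.exp (C * δ ^ v / ε ^ 2) ≤ Z := by rw [← h2]; gcongr
      _ ≤ Z ^ 2 / (2 * Real.pi) / 4 := by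
        rw [div_div, le_div_iff₀ (by positivity)]; nlinarith
      _ ≤ _ := by gcongr; exact h4.trans h3

end LowerBound

end CompositeEstimation

namespace CompositeEstimation

/-! ### Hölder classes and scaling of derivatives -/

section Holder

open scoped ContDiff

lemma holderOrder_lt {α : ℝ} (hα : 0 < α) : (holderOrder α : ℝ) < α := by
  have h : 0 < ⌈α⌉₊ := Nat.ceil_pos.2 hα
  have h1 : ((holderOrder α + 1 : ℕ) : ℝ) = (⌈α⌉₊ : ℝ) := by
    rw [holderOrder, Nat.sub_add_cancel h]
  have h2 := Nat.ceil_lt_add_one hα.le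
  push_cast at h1
  linarith

lemma le_holderOrder_add_one {α : ℝ} (hα : 0 < α) : α ≤ holderOrder α + 1 := by
  have h : 0 < ⌈α⌉₊ := Nat.ceil_pos.2 hα
  have h1 : ((holderOrder α + 1 : ℕ) : ℝ) = (⌈α⌉₊ : ℝ) := by
    rw [holderOrder, Nat.sub_add_cancel h]
  have h2 := Nat.le_ceil α
  push_cast at h1
  linarith

/-- Taylor remainder over a unit step of a function whose derivatives are those of a function of
Hölder size `M`, varying at scale `δ`, along a segment of length `τ`. -/
lemma abs_sub_taylor_le {φ : ℝ → ℝ} (hφ : ContDiff ℝ ∞ φ) {m : ℕ} {β M δ τ : ℝ} (hδ : 0 < δ)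
    (hτ : 0 ≤ τ) (hM : 0 ≤ M) (hm : m < β) (hm' : β ≤ m + 1)
    (hb : ∀ n ≤ m + 1, ∀ s, |iteratedDeriv n φ s| ≤ M * δ ^ (β - n) * τ ^ n) :
    |φ 1 - ∑ n ∈ Finset.range (m + 1), iteratedDeriv n φ 0 / n.factorial| ≤ (m + 2) * M * τ ^ β := by
  -- Short steps use the Taylor remainder with the derivative of order m + 1, whose exponent β - (m
  -- + 1) is nonpositive. On long steps there is no cancellation, and each of the m + 2 terms is at
  -- most M τ^β.
  rcases le_or_gt τ δ with hτδ | hτδ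
  · have hC : M * δ ^ (β - (m + 1 : ℕ)) * τ ^ (m + 1) ≤ M * τ ^ β := by
      rcases hτ.eq_or_lt with rfl | hτ
      · rw [zero_pow (by omega), mul_zero]; positivity
      · rw [mul_assoc]
        gcongr
        calc δ ^ (β - (m + 1 : ℕ)) * τ ^ (m + 1) ≤ τ ^ (β - (m + 1 : ℕ)) * τ ^ (m + 1) := by
              gcongr ?_ * _
              exact Real.rpow_le_rpow_of_nonpos hτ hτδ (by push_cast; linarith)
          _ = τ ^ β := by
              rw [← Real.rpow_natCast, ← Real.rpow_add hτ]; congr 1; ring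
    have hwithin : ∀ n : ℕ, ∀ s ∈ Set.Icc (0 : ℝ) 1,
        iteratedDerivWithin n φ (Set.Icc 0 1) s = iteratedDeriv n φ s := fun n s hs =>
      iteratedDerivWithin_eq_iteratedDeriv (uniqueDiffOn_Icc one_pos)
        (hφ.contDiffAt.of_le (by exact_mod_cast le_top)) hs
    have h := taylor_mean_remainder_bound (f := φ) (a := 0) (b := 1) (x := 1) (n := m)
      (C := M * δ ^ (β - (m + 1 : ℕ)) * τ ^ (m + 1)) zero_le_one
      (hφ.contDiffOn.of_le (by exact_mod_cast le_top)) (by simp)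
      (fun s hs => by rw [hwithin _ s hs]; exact hb _ le_rfl s)
    rw [taylor_within_apply] at h
    have e : ∑ n ∈ Finset.range (m + 1), iteratedDeriv n φ 0 / n.factorial
        = ∑ k ∈ Finset.range (m + 1), ((k.factorial : ℝ)⁻¹ * (1 - 0) ^ k)
          • iteratedDerivWithin k φ (Set.Icc 0 1) 0 := by
      refine Finset.sum_congr rfl fun k _ => ?_
      rw [hwithin k 0 (by simp)]
      simp [div_eq_inv_mul]
    rw [e, ← Real.norm_eq_abs]
    refine h.trans ?_
    have h1 : (1 : ℝ) ≤ m.factorial := by exact_mod_cast Nat.factorial_pos m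
    rw [sub_zero, one_pow, mul_one]
    have h0 : 0 ≤ M * τ ^ β := by positivity
    calc _ ≤ M * δ ^ (β - (m + 1 : ℕ)) * τ ^ (m + 1) := div_le_self (by positivity) h1
      _ ≤ M * τ ^ β := hC
      _ ≤ (m + 2) * M * τ ^ β := by nlinarith [(Nat.cast_nonneg m : (0 : ℝ) ≤ m)]
  · have hτ0 : 0 < τ := hδ.trans hτδ
    have hterm : ∀ n ≤ m, ∀ s, |iteratedDeriv n φ s| ≤ M * τ ^ β := by
      intro n hn s
      have hn' : (n : ℝ) ≤ m := by exact_mod_cast hn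
      refine (hb n (by omega) s).trans ?_
      rw [mul_assoc]
      gcongr
      calc δ ^ (β - n) * τ ^ n ≤ τ ^ (β - n) * τ ^ n := by
            gcongr; linarith
        _ = τ ^ β := by rw [← Real.rpow_natCast, ← Real.rpow_add hτ0]; congr 1; ring
    have h0 : |φ 1| ≤ M * τ ^ β := by simpa using hterm 0 (by omega) 1
    have hsum : |∑ n ∈ Finset.range (m + 1), iteratedDeriv n φ 0 / n.factorial|
        ≤ ∑ _n ∈ Finset.range (m + 1), M * τ ^ β := by
      refine (Finset.abs_sum_le_sum_abs _ _).trans (Finset.sum_le_sum fun n hn => ?_)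
      have h1 : (1 : ℝ) ≤ n.factorial := by exact_mod_cast Nat.factorial_pos n
      rw [abs_div, Nat.abs_cast]
      exact (div_le_self (abs_nonneg _) h1).trans
        (hterm n (by simpa [Nat.lt_succ_iff] using hn) 0)
    rw [Finset.sum_const, Finset.card_range, nsmul_eq_mul] at hsum
    push_cast at hsum
    refine (abs_sub _ _).trans ?_
    linarith

/-- A smooth function whose derivatives scale as those of `h ^ γ F (· / h)` is Hölder. -/
lemma IsHolderReal.of_iteratedDeriv_le {γ L M h : ℝ} {f : ℝ → ℝ} (hγ : 0 < γ) (hh : 0 < h)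
    (hh1 : h ≤ 1) (hM : 0 ≤ M) (hf : ContDiff ℝ ∞ f)
    (hb : ∀ n ≤ holderOrder γ + 1, ∀ u, |iteratedDeriv n f u| ≤ M * h ^ (γ - n))
    (hL : (holderOrder γ + 2) * M ≤ L) : IsHolderReal γ L f where
  contDiff := hf.of_le (by exact_mod_cast le_top)
  bound := by
    have hlt := holderOrder_lt hγ
    calc ∑ n ∈ Finset.range (holderOrder γ + 1), ⨆ u, ‖iteratedDeriv n f u‖ₑ
        ≤ ∑ _n ∈ Finset.range (holderOrder γ + 1), ENNReal.ofReal M := by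
          refine Finset.sum_le_sum fun n hn => iSup_le fun u => ?_
          have hn' : n ≤ holderOrder γ := by simpa [Nat.lt_succ_iff] using hn
          have hn'' : (n : ℝ) ≤ holderOrder γ := by exact_mod_cast hn'
          rw [Real.enorm_eq_ofReal_abs]
          refine ENNReal.ofReal_le_ofReal ((hb n (by omega) u).trans ?_)
          exact mul_le_of_le_one_right hM (Real.rpow_le_one hh.le hh1 (by linarith))
      _ = ENNReal.ofReal ((holderOrder γ + 1) * M) := by
          rw [Finset.sum_const, Finset.card_range, nsmul_eq_mul, ENNReal.ofReal_mul (by positivity)]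
          congr 1
          rw [ENNReal.ofReal_add (by positivity) zero_le_one]
          simp
      _ ≤ ENNReal.ofReal L := ENNReal.ofReal_le_ofReal (by linarith)
  taylor u v := by
    let φ : ℝ → ℝ := fun s => f (u + (v - u) * s)
    have hφ : ContDiff ℝ ∞ φ := by fun_prop
    have hder : ∀ n s, iteratedDeriv n φ s = (v - u) ^ n * iteratedDeriv n f (u + (v - u) * s) := by
      intro n s
      have h1 : ContDiff ℝ n (fun t => f (u + t)) :=
        (hf.comp (contDiff_const.add contDiff_id)).of_le (by exact_mod_cast le_top)
      have h2 := congrFun (iteratedDeriv_comp_const_mul h1 (v - u)) s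
      rw [iteratedDeriv_comp_const_add] at h2
      exact h2
    have key := abs_sub_taylor_le hφ hh (abs_nonneg (v - u)) hM (holderOrder_lt hγ)
      (le_holderOrder_add_one hγ) (fun n hn s => by
        rw [hder, abs_mul, abs_pow, mul_comm]
        gcongr
        exact hb n hn _)
    have e1 : φ 1 = f v := by simp [φ]
    have e2 : ∑ n ∈ Finset.range (holderOrder γ + 1), iteratedDeriv n φ 0 / n.factorial
        = ∑ n ∈ Finset.range (holderOrder γ + 1),
          iteratedDeriv n f u * ((v - u) ^ n / (n.factorial : ℝ)) := by
      refine Finset.sum_congr rfl fun n _ => ?_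
      rw [hder, mul_zero, add_zero]; ring
    rw [e1, e2] at key
    exact key.trans (by gcongr)

/-! ### Partial derivatives as commuting operators on smooth functions -/

variable {d : ℕ}

/-- The space of smooth functions on `ℝ^d`. -/
def smoothFunctions (d : ℕ) : Submodule ℝ (EuclideanSpace ℝ (Fin d) → ℝ) where
  carrier := {G | ContDiff ℝ ∞ G}
  add_mem' {F G} (hF : ContDiff ℝ ∞ F) (hG : ContDiff ℝ ∞ G) := hF.add hG
  zero_mem' := (contDiff_const : ContDiff ℝ ∞ fun _ => (0 : ℝ))
  smul_mem' c G (hG : ContDiff ℝ ∞ G) := hG.const_smul c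

lemma smoothFunctions.contDiff (G : smoothFunctions d) : ContDiff ℝ ∞ G.1 := G.2

lemma smoothFunctions.differentiable (G : smoothFunctions d) : Differentiable ℝ G.1 :=
  (smoothFunctions.contDiff G).differentiable (by simp)

lemma smoothFunctions.lineDeriv_eq (G : smoothFunctions d) (x v : EuclideanSpace ℝ (Fin d)) :
    lineDeriv ℝ (G : EuclideanSpace ℝ (Fin d) → ℝ) x v = fderiv ℝ G.1 x v :=
  ((smoothFunctions.differentiable G) x).lineDeriv_eq_fderiv

/-- Directional derivative as an endomorphism of the space of smooth functions. -/
noncomputable def dirDeriv (v : EuclideanSpace ℝ (Fin d)) : Module.End ℝ (smoothFunctions d) where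
  toFun G := ⟨fun x => lineDeriv ℝ G.1 x v, by
    have : (fun x => lineDeriv ℝ G.1 x v) = fun x => fderiv ℝ G.1 x v :=
      funext fun x => smoothFunctions.lineDeriv_eq G x v
    rw [this]
    have h : ContDiff ℝ ∞ fun x => fderiv ℝ G.1 x v :=
      ((smoothFunctions.contDiff G).fderiv_right (m := ∞) (by simp)).clm_apply contDiff_const
    exact h⟩
  map_add' F G := by
    ext x
    have := smoothFunctions.lineDeriv_eq (F + G) x v
    simp only [Submodule.coe_add, Pi.add_apply, smoothFunctions.lineDeriv_eq] at this ⊢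
    rw [this, fderiv_add ((smoothFunctions.differentiable F) x) ((smoothFunctions.differentiable G) x)]
    rfl
  map_smul' c G := by
    ext x
    have := smoothFunctions.lineDeriv_eq (c • G) x v
    simp only [Submodule.coe_smul, Pi.smul_apply, smoothFunctions.lineDeriv_eq,
      RingHom.id_apply] at this ⊢
    rw [this, fderiv_const_smul ((smoothFunctions.differentiable G) x)]
    rfl

lemma dirDeriv_apply (v : EuclideanSpace ℝ (Fin d)) (G : smoothFunctions d)
    (x : EuclideanSpace ℝ (Fin d)) : (dirDeriv v G).1 x = fderiv ℝ G.1 x v :=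
  smoothFunctions.lineDeriv_eq G x v

/-- Symmetry of the second derivative. It makes the multinomial theorem available for powers of a
directional derivative. -/
lemma commute_dirDeriv (v w : EuclideanSpace ℝ (Fin d)) : Commute (dirDeriv v) (dirDeriv w) := by
  have h2 : ∀ (v w : EuclideanSpace ℝ (Fin d)) (G : smoothFunctions d)
      (x : EuclideanSpace ℝ (Fin d)),
      (dirDeriv v (dirDeriv w G)).1 x = fderiv ℝ (fderiv ℝ G.1) x v w := by
    intro v w G x
    rw [dirDeriv_apply]
    have : (dirDeriv w G).1 = fun x => fderiv ℝ G.1 x w := funext fun x => dirDeriv_apply w G x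
    rw [this, fderiv_clm_apply
      ((((smoothFunctions.contDiff G).fderiv_right (m := ∞) (by simp)).differentiable (by simp)) x)
      (differentiableAt_const _)]
    simp
  ext G x
  simp only [Module.End.mul_apply]
  rw [h2, h2]
  exact ((smoothFunctions.contDiff G).contDiffAt (x := x)).isSymmSndFDerivAt
    (by rw [minSmoothness_of_isRCLikeNormedField]; exact WithTop.coe_le_coe.2 le_top) v w

lemma dirDeriv_eq_sum (v : EuclideanSpace ℝ (Fin d)) :
    dirDeriv v = ∑ i, v i • dirDeriv (EuclideanSpace.single i (1 : ℝ)) := by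
  ext G x
  have h1 : ((∑ i, v i • dirDeriv (EuclideanSpace.single i (1 : ℝ))) G).1 x
      = ∑ i, v i * fderiv ℝ G.1 x (EuclideanSpace.single i (1 : ℝ)) := by
    rw [LinearMap.sum_apply, Submodule.coe_sum, Finset.sum_apply]
    simp only [LinearMap.smul_apply, Submodule.coe_smul, Pi.smul_apply, dirDeriv_apply, smul_eq_mul]
  rw [h1, dirDeriv_apply]
  conv_lhs => rw [← (EuclideanSpace.basisFun (Fin d) ℝ).sum_repr v]
  simp [map_sum]

lemma prod_map_dirDeriv_apply (l : List (EuclideanSpace ℝ (Fin d))) (G : smoothFunctions d)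
    (x : EuclideanSpace ℝ (Fin d)) :
    ((l.map dirDeriv).prod G).1 x = iteratedFDeriv ℝ l.length G.1 x l.get := by
  induction l generalizing x with
  | nil => simp
  | cons a l ih =>
    rw [List.map_cons, List.prod_cons, Module.End.mul_apply, dirDeriv_apply, funext ih]
    refine Eq.trans ?_ (iteratedFDeriv_succ_apply_left (n := l.length) (a :: l).get).symm
    rw [fderiv_continuousMultilinear_apply_const_apply]
    · rfl
    · exact ((smoothFunctions.contDiff G).contDiffAt (x := x)).differentiableAt_iteratedFDeriv
        (by exact_mod_cast ENat.natCast_lt_top _)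

lemma abs_prod_map_dirDeriv_le (l : List (EuclideanSpace ℝ (Fin d))) (G : smoothFunctions d)
    (x : EuclideanSpace ℝ (Fin d)) :
    |((l.map dirDeriv).prod G).1 x| ≤ ‖iteratedFDeriv ℝ l.length G.1 x‖ * (l.map norm).prod := by
  rw [prod_map_dirDeriv_apply, ← Real.norm_eq_abs]
  refine (ContinuousMultilinearMap.le_opNorm _ _).trans (le_of_eq ?_)
  congr 1
  rw [← List.prod_ofFn]
  congr 1
  conv_rhs => rw [← List.ofFn_get l]
  rw [List.map_ofFn]
  rfl

lemma mixedPartial_eq_prod (k : Fin d → ℕ) (G : smoothFunctions d) :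
    mixedPartial k G.1 = (((List.finRange d).map fun i =>
      dirDeriv (EuclideanSpace.single i (1 : ℝ)) ^ k i).prod G).1 := by
  unfold mixedPartial
  generalize List.finRange d = l
  induction l with
  | nil => simp
  | cons i l ih =>
    rw [List.foldr_cons, ih, List.map_cons, List.prod_cons, Module.End.mul_apply]
    generalize (l.map fun i => dirDeriv (EuclideanSpace.single i (1 : ℝ)) ^ k i).prod G = F
    induction k i with
    | zero => simp
    | succ n ihn =>
      rw [Function.iterate_succ_apply', ihn, pow_succ', Module.End.mul_apply]
      rfl

lemma abs_mixedPartial_le (k : Fin d → ℕ) (G : smoothFunctions d) (x : EuclideanSpace ℝ (Fin d)) :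
    |mixedPartial k G.1 x| ≤ ‖iteratedFDeriv ℝ (∑ i, k i) G.1 x‖ := by
  -- The multi-index spelled out as a word of unit vectors, so that the operator norm bound has no
  -- extra factor.
  let l := (List.finRange d).flatMap fun i => List.replicate (k i) (EuclideanSpace.single i (1 : ℝ))
  have h1 : (l.map dirDeriv).prod = ((List.finRange d).map fun i =>
      dirDeriv (EuclideanSpace.single i (1 : ℝ)) ^ k i).prod := by
    simp only [l]
    induction List.finRange d with
    | nil => simp
    | cons i l ih => simp [ih]
  have h2 : l.length = ∑ i, k i := by
    simp [l, List.length_flatMap, ← List.sum_ofFn, List.ofFn_eq_map]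
  have h3 : (l.map norm).prod = 1 := by
    refine List.prod_eq_one fun y hy => ?_
    simp only [l, List.mem_map, List.mem_flatMap, List.mem_replicate] at hy
    obtain ⟨_, ⟨i, _, _, rfl⟩, rfl⟩ := hy
    simp
  have := abs_prod_map_dirDeriv_le l G x
  rwa [h1, h2, h3, mul_one, ← mixedPartial_eq_prod] at this

lemma abs_dirDeriv_pow_le (n : ℕ) (v : EuclideanSpace ℝ (Fin d)) (G : smoothFunctions d)
    (x : EuclideanSpace ℝ (Fin d)) :
    |((dirDeriv v ^ n) G).1 x| ≤ ‖iteratedFDeriv ℝ n G.1 x‖ * ‖v‖ ^ n := by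
  have h := abs_prod_map_dirDeriv_le (List.replicate n v) G x
  rw [List.length_replicate] at h
  simpa using h

lemma iteratedDeriv_comp_line (G : smoothFunctions d) (x v : EuclideanSpace ℝ (Fin d)) (n : ℕ)
    (s : ℝ) : iteratedDeriv n (fun s : ℝ => G.1 (x + s • v)) s
      = ((dirDeriv v ^ n) G).1 (x + s • v) := by
  induction n generalizing s with
  | zero => simp
  | succ n ih =>
    rw [iteratedDeriv_succ, funext ih, pow_succ', Module.End.mul_apply]
    change deriv (fun s : ℝ => ((dirDeriv v ^ n) G).1 (x + s • v)) s
      = lineDeriv ℝ ((dirDeriv v ^ n) G).1 (x + s • v) v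
    rw [smoothFunctions.lineDeriv_eq]
    have h1 : HasDerivAt (fun s : ℝ => x + s • v) v s := by
      simpa using ((hasDerivAt_id s).smul_const v).const_add x
    have h2 := ((smoothFunctions.differentiable ((dirDeriv v ^ n) G)) (x + s • v)).hasFDerivAt
    exact (h2.comp_hasDerivAt s h1).deriv

/-- The multinomial expansion of the iterated directional derivative. -/
lemma sum_mixedPartial_mul_prod (G : smoothFunctions d) (x v : EuclideanSpace ℝ (Fin d)) (n : ℕ) :
    ∑ k ∈ Finset.piAntidiag (Finset.univ : Finset (Fin d)) n,
      mixedPartial k G.1 x * ∏ j, v j ^ k j / ((k j).factorial : ℝ)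
      = ((dirDeriv v ^ n) G).1 x / n.factorial := by
  have hcomm : ((Finset.univ : Finset (Fin d)) : Set (Fin d)).Pairwise fun i j =>
      Commute (v i • dirDeriv (EuclideanSpace.single i (1 : ℝ)))
        (v j • dirDeriv (EuclideanSpace.single j (1 : ℝ))) := fun i _ j _ _ =>
    ((commute_dirDeriv _ _).smul_left _).smul_right _
  rw [dirDeriv_eq_sum v, Finset.sum_pow_eq_sum_piAntidiag_of_commute _ _ hcomm,
    LinearMap.sum_apply, Submodule.coe_sum, Finset.sum_apply, Finset.sum_div]
  refine Finset.sum_congr rfl fun k hk => ?_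
  have hkn : ∑ i, k i = n := (Finset.mem_piAntidiag.1 hk).1
  have hprod : ∀ (hc), (Finset.univ : Finset (Fin d)).noncommProd
      (fun i => (v i • dirDeriv (EuclideanSpace.single i (1 : ℝ))) ^ k i) hc
      = (∏ i, v i ^ k i) • ((List.finRange d).map fun i =>
        dirDeriv (EuclideanSpace.single i (1 : ℝ)) ^ k i).prod := by
    intro hc
    have h1 : (Finset.univ : Finset (Fin d)).noncommProd
      (fun i => (v i • dirDeriv (EuclideanSpace.single i (1 : ℝ))) ^ k i) hc
      = ((List.finRange d).map fun i =>
        (v i • dirDeriv (EuclideanSpace.single i (1 : ℝ))) ^ k i).prod := by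
      simp only [Finset.noncommProd]
      exact Multiset.noncommProd_coe _ _
    rw [h1, ← List.prod_ofFn, List.ofFn_eq_map]
    generalize List.finRange d = l
    induction l with
    | nil => simp
    | cons i l ih =>
      rw [List.map_cons, List.prod_cons, ih, smul_pow, smul_mul_smul_comm]
      simp only [List.map_cons, List.prod_cons]
  have hval : ∀ (m : ℕ) (c : ℝ) (A : Module.End ℝ (smoothFunctions d)),
      (((m : Module.End ℝ (smoothFunctions d)) * c • A) G).1 x = m * (c * (A G).1 x) := by
    intro m c A
    rw [← nsmul_eq_mul, ← Nat.cast_smul_eq_nsmul ℝ]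
    rfl
  rw [hprod, hval, ← mixedPartial_eq_prod, Finset.prod_div_distrib]
  have hspec : (∏ i, ((k i).factorial : ℝ)) * Nat.multinomial Finset.univ k = n.factorial := by
    rw [← hkn]; exact_mod_cast Nat.multinomial_spec Finset.univ k
  have hne : (∏ i, ((k i).factorial : ℝ)) ≠ 0 :=
    Finset.prod_ne_zero_iff.2 fun i _ => by positivity
  have hne' : (n.factorial : ℝ) ≠ 0 := by positivity
  rw [← hspec] at hne' ⊢
  have hne2 : (Nat.multinomial Finset.univ k : ℝ) ≠ 0 := right_ne_zero_of_mul hne'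
  field_simp

/-- The Taylor polynomial of the Hölder class is that of the restriction to a line. -/
lemma sum_taylor_eq (G : smoothFunctions d) (x v : EuclideanSpace ℝ (Fin d)) (N : ℕ) :
    ∑ n ∈ Finset.range N, ∑ k ∈ Finset.piAntidiag (Finset.univ : Finset (Fin d)) n,
      mixedPartial k G.1 x * ∏ j, v j ^ k j / ((k j).factorial : ℝ)
      = ∑ n ∈ Finset.range N, iteratedDeriv n (fun s : ℝ => G.1 (x + s • v)) 0 / n.factorial := by
  refine Finset.sum_congr rfl fun n _ => ?_
  rw [sum_mixedPartial_mul_prod, iteratedDeriv_comp_line, zero_smul, add_zero]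

/-- A constant bounding the number of terms in the definition of the Hölder class. -/
noncomputable def holderConst (d : ℕ) (β : ℝ) : ℝ :=
  holderOrder β + 2 + ∑ n ∈ Finset.range (holderOrder β + 1),
    ((Finset.piAntidiag (Finset.univ : Finset (Fin d)) n).card : ℝ)

lemma holderConst_pos (d : ℕ) (β : ℝ) : 0 < holderConst d β := by
  unfold holderConst; positivity

/-- A smooth function whose derivatives scale as those of `δ ^ β ψ (· / δ)` is Hölder. -/
lemma IsHolder.of_iteratedFDeriv_le {β L M δ : ℝ} {G : EuclideanSpace ℝ (Fin d) → ℝ} (hβ : 0 < β)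
    (hδ : 0 < δ) (hδ1 : δ ≤ 1) (hM : 0 ≤ M) (hG : ContDiff ℝ ∞ G)
    (hb : ∀ n ≤ holderOrder β + 1, ∀ x, ‖iteratedFDeriv ℝ n G x‖ ≤ M * δ ^ (β - n))
    (hL : holderConst d β * M ≤ L) : IsHolder d β L G where
  contDiff := hG.of_le (by exact_mod_cast le_top)
  bound := by
    have hlt := holderOrder_lt hβ
    calc ∑ n ∈ Finset.range (holderOrder β + 1),
          ∑ k ∈ Finset.piAntidiag (Finset.univ : Finset (Fin d)) n, ⨆ x, ‖mixedPartial k G x‖ₑ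
        ≤ ∑ n ∈ Finset.range (holderOrder β + 1),
          ∑ _k ∈ Finset.piAntidiag (Finset.univ : Finset (Fin d)) n, ENNReal.ofReal M := by
          refine Finset.sum_le_sum fun n hn => Finset.sum_le_sum fun k hk => iSup_le fun x => ?_
          have hn' : n ≤ holderOrder β := by simpa [Nat.lt_succ_iff] using hn
          have hn'' : (n : ℝ) ≤ holderOrder β := by exact_mod_cast hn'
          have hkn : ∑ i, k i = n := (Finset.mem_piAntidiag.1 hk).1
          have h1 := abs_mixedPartial_le k ⟨G, hG⟩ x
          rw [hkn] at h1
          rw [Real.enorm_eq_ofReal_abs]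
          refine ENNReal.ofReal_le_ofReal (h1.trans ((hb n (by omega) x).trans ?_))
          exact mul_le_of_le_one_right hM (Real.rpow_le_one hδ.le hδ1 (by linarith))
      _ = ENNReal.ofReal ((∑ n ∈ Finset.range (holderOrder β + 1),
            ((Finset.piAntidiag (Finset.univ : Finset (Fin d)) n).card : ℝ)) * M) := by
          simp only [Finset.sum_const, nsmul_eq_mul]
          rw [← Finset.sum_mul, ENNReal.ofReal_mul (by positivity),
            ENNReal.ofReal_sum_of_nonneg fun _ _ => by positivity]
          simp
      _ ≤ ENNReal.ofReal L := by
          refine ENNReal.ofReal_le_ofReal (le_trans ?_ hL)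
          unfold holderConst
          gcongr
          linarith [(Nat.cast_nonneg (holderOrder β) : (0 : ℝ) ≤ _)]
  taylor x y := by
    have key := abs_sub_taylor_le (φ := fun s : ℝ => G (x + s • (y - x))) (by fun_prop) hδ
      (norm_nonneg (y - x)) hM (holderOrder_lt hβ) (le_holderOrder_add_one hβ) (fun n hn s => by
        rw [iteratedDeriv_comp_line ⟨G, hG⟩]
        exact (abs_dirDeriv_pow_le n (y - x) ⟨G, hG⟩ _).trans (by gcongr; exact hb n hn _))
    rw [← sum_taylor_eq ⟨G, hG⟩] at key
    simp only [one_smul, add_sub_cancel, PiLp.sub_apply] at key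
    refine key.trans ?_
    gcongr
    refine le_trans ?_ hL
    unfold holderConst
    exact mul_le_mul_of_nonneg_right (le_add_of_nonneg_right (by positivity)) hM

/-- Sums of smooth Hölder functions are Hölder. -/
lemma IsHolder.add {β L L' : ℝ} (hL : 0 ≤ L) (hL' : 0 ≤ L') {F G : EuclideanSpace ℝ (Fin d) → ℝ}
    (hF : ContDiff ℝ ∞ F) (hG : ContDiff ℝ ∞ G) (hFL : IsHolder d β L F)
    (hGL : IsHolder d β L' G) : IsHolder d β (L + L') (F + G) := by
  have hadd : ∀ k, mixedPartial k (F + G) = mixedPartial k F + mixedPartial k G := by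
    intro k
    let F' : smoothFunctions d := ⟨F, hF⟩
    let G' : smoothFunctions d := ⟨G, hG⟩
    have h := mixedPartial_eq_prod k (F' + G')
    rw [map_add] at h
    exact h.trans (congrArg₂ (· + ·) (mixedPartial_eq_prod k F').symm
      (mixedPartial_eq_prod k G').symm)
  refine ⟨hFL.contDiff.add hGL.contDiff, ?_, fun x y => ?_⟩
  · rw [ENNReal.ofReal_add hL hL']
    refine le_trans ?_ (add_le_add hFL.bound hGL.bound)
    simp only [← Finset.sum_add_distrib]
    refine Finset.sum_le_sum fun n _ => Finset.sum_le_sum fun k _ => iSup_le fun x => ?_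
    rw [hadd, Pi.add_apply]
    exact (enorm_add_le _ _).trans (add_le_add (le_iSup (fun x => ‖mixedPartial k F x‖ₑ) x)
      (le_iSup (fun x => ‖mixedPartial k G x‖ₑ) x))
  · simp only [hadd, Pi.add_apply, add_mul, Finset.sum_add_distrib]
    rw [add_sub_add_comm]
    exact (abs_add_le _ _).trans (add_le_add (hFL.taylor x y) (hGL.taylor x y))

/-- All derivatives of a smooth compactly supported function are bounded. -/
lemma exists_iteratedFDeriv_le_of_hasCompactSupport {E : Type*} [NormedAddCommGroup E]
    [NormedSpace ℝ E] {ψ : E → ℝ} (hψ : ContDiff ℝ ∞ ψ) (hc : HasCompactSupport ψ) (N : ℕ) :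
    ∃ M, 0 < M ∧ ∀ n ≤ N, ∀ x, ‖iteratedFDeriv ℝ n ψ x‖ ≤ M := by
  have h : ∀ n : ℕ, ∃ C, ∀ x, ‖iteratedFDeriv ℝ n ψ x‖ ≤ C := fun n =>
    (hψ.continuous_iteratedFDeriv (m := n)
      (by exact_mod_cast le_top)).bounded_above_of_compact_support (hc.iteratedFDeriv n)
  choose C hC using h
  refine ⟨1 + ∑ n ∈ Finset.range (N + 1), |C n|, by positivity, fun n hn x => ?_⟩
  have := Finset.single_le_sum (f := fun n => |C n|) (fun i _ => abs_nonneg _)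
    (Finset.mem_range.2 (Nat.lt_succ_of_le hn))
  linarith [hC n x, le_abs_self (C n)]

/-- Derivatives of a rescaled function. -/
lemma norm_iteratedFDeriv_rescale_le {ψ : EuclideanSpace ℝ (Fin d) → ℝ} (hψ : ContDiff ℝ ∞ ψ)
    {M : ℝ} {n : ℕ} (hM : ∀ x, ‖iteratedFDeriv ℝ n ψ x‖ ≤ M) {δ β c : ℝ} (hδ : 0 < δ) (hc : 0 ≤ c)
    (x₀ x : EuclideanSpace ℝ (Fin d)) :
    ‖iteratedFDeriv ℝ n (fun x => c * δ ^ β * ψ (δ⁻¹ • (x - x₀))) x‖ ≤ c * M * δ ^ (β - n) := by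
  have h1 : ContDiff ℝ n ψ := hψ.of_le (by exact_mod_cast le_top)
  have h2 : ContDiff ℝ n fun z : EuclideanSpace ℝ (Fin d) => ψ (δ⁻¹ • z) :=
    h1.comp (contDiff_const_smul _)
  have e : (fun x => c * δ ^ β * ψ (δ⁻¹ • (x - x₀)))
      = fun x => (c * δ ^ β) • (fun z => ψ (δ⁻¹ • z)) (x - x₀) := rfl
  have h3 : ContDiff ℝ n fun x : EuclideanSpace ℝ (Fin d) => (fun z => ψ (δ⁻¹ • z)) (x - x₀) :=
    h2.comp (contDiff_id.sub contDiff_const)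
  rw [e, iteratedFDeriv_const_smul_apply' h3.contDiffAt]
  rw [show iteratedFDeriv ℝ n (fun x => (fun z => ψ (δ⁻¹ • z)) (x - x₀)) x
    = iteratedFDeriv ℝ n (fun z => ψ (δ⁻¹ • z)) (x - x₀) from
      iteratedFDeriv_comp_sub (𝕜 := ℝ) (f := fun z => ψ (δ⁻¹ • z)) n x₀ x,
    iteratedFDeriv_comp_const_smul _ h1, norm_smul, norm_smul, Real.norm_of_nonneg (by positivity),
    Real.norm_of_nonneg (by positivity)]
  calc c * δ ^ β * (δ⁻¹ ^ n * ‖iteratedFDeriv ℝ n ψ (δ⁻¹ • (x - x₀))‖)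
      ≤ c * δ ^ β * (δ⁻¹ ^ n * M) := by gcongr; exact hM _
    _ = c * M * δ ^ (β - n) := by
      rw [Real.rpow_sub hδ, Real.rpow_natCast, inv_pow]; ring

end Holder

end CompositeEstimation

namespace CompositeEstimation

/-! ### The two families of hypotheses -/

section Construction

open scoped ContDiff

/-- Rescaling a smooth function with bounded derivatives to a Hölder function. -/
lemma isHolderReal_rescale {γ L M c h : ℝ} {F : ℝ → ℝ} (hγ : 0 < γ) (hh : 0 < h) (hh1 : h ≤ 1)
    (hM : 0 ≤ M) (hc : 0 ≤ c) (hF : ContDiff ℝ ∞ F)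
    (hb : ∀ n ≤ holderOrder γ + 1, ∀ u, |iteratedDeriv n F u| ≤ M)
    (hL : (holderOrder γ + 2) * (c * M) ≤ L) :
    IsHolderReal γ L fun u => c * h ^ γ * F (h⁻¹ * u) := by
  refine IsHolderReal.of_iteratedDeriv_le hγ hh hh1 (M := c * M) (by positivity) (by fun_prop)
    (fun n hn u => ?_) hL
  rw [iteratedDeriv_const_mul_field,
    iteratedDeriv_comp_const_mul (hF.of_le (by exact_mod_cast le_top)), abs_mul (c * h ^ γ),
    abs_mul (h⁻¹ ^ n), abs_of_nonneg (by positivity : 0 ≤ c * h ^ γ),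
    abs_of_nonneg (by positivity : 0 ≤ h⁻¹ ^ n)]
  calc c * h ^ γ * (h⁻¹ ^ n * |iteratedDeriv n F (h⁻¹ * u)|)
      ≤ c * h ^ γ * (h⁻¹ ^ n * M) := by gcongr; exact hb n hn _
    _ = c * M * h ^ (γ - n) := by
      rw [Real.rpow_sub hh, Real.rpow_natCast, inv_pow]; ring

variable {d : ℕ}

/-- Small multiples of rescaled translates of a test function are Hölder. -/
lemma exists_isHolder_rescale {β L : ℝ} (hβ : 0 < β) (hL : 0 < L)
    {ψ : EuclideanSpace ℝ (Fin d) → ℝ} (hψ : ContDiff ℝ ∞ ψ) (hc : HasCompactSupport ψ) :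
    ∃ c₀ > 0, ∀ c, 0 ≤ c → c ≤ c₀ → ∀ δ, 0 < δ → δ ≤ 1 → ∀ x₀,
      IsHolder d β L fun x => c * δ ^ β * ψ (δ⁻¹ • (x - x₀)) := by
  obtain ⟨M, hM0, hM⟩ := exists_iteratedFDeriv_le_of_hasCompactSupport hψ hc (holderOrder β + 1)
  have hpos := holderConst_pos d β
  refine ⟨L / (holderConst d β * M), by positivity, fun c hc0 hc δ hδ hδ1 x₀ => ?_⟩
  refine IsHolder.of_iteratedFDeriv_le hβ hδ hδ1 (M := c * M) (by positivity) ?_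
    (fun n hn x => norm_iteratedFDeriv_rescale_le hψ (hM n hn) hδ hc0 x₀ x) ?_
  · exact contDiff_const.mul (hψ.comp ((contDiff_id.sub contDiff_const).const_smul _))
  · rw [le_div_iff₀ (by positivity)] at hc
    linarith

/-- A bounded continuous function supported in a box is in `L²`, with the obvious bound. -/
lemma memLp_and_integral_sq_le {h : EuclideanSpace ℝ (Fin d) → ℝ} (hh : Continuous h) {B : ℝ}
    (hB : ∀ y, |h y| ≤ B) (z : EuclideanSpace ℝ (Fin d)) {ρ : Fin d → ℝ} (hρ : ∀ i, 0 ≤ ρ i)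
    (hsupp : ∀ y, h y ≠ 0 → ∀ i, |y i - z i| ≤ ρ i) :
    MemLp h 2 volume ∧ ∫ y, h y ^ 2 ≤ B ^ 2 * ∏ i, 2 * ρ i := by
  let S : Set (EuclideanSpace ℝ (Fin d)) := {y | ∀ i, y i ∈ Set.Icc (z i - ρ i) (z i + ρ i)}
  have hS : IsCompact S := by
    have : S = (EuclideanSpace.equiv (Fin d) ℝ) ⁻¹'
        Set.univ.pi fun i => Set.Icc (z i - ρ i) (z i + ρ i) := by
      ext x
      simp only [S, Set.mem_ofPred_eq, Set.mem_preimage, Set.mem_univ_pi]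
      rfl
    rw [this]
    exact (EuclideanSpace.equiv (Fin d) ℝ).toHomeomorph.isCompact_preimage.2
      (isCompact_univ_pi fun i => isCompact_Icc)
  have hzero : ∀ y, y ∉ S → h y = 0 := by
    intro y hy
    by_contra hne
    exact hy fun i => by
      have := abs_le.1 (hsupp y hne i)
      constructor <;> linarith [this.1, this.2]
  have hcs : HasCompactSupport h := HasCompactSupport.intro hS hzero
  refine ⟨hh.memLp_of_hasCompactSupport hcs, ?_⟩
  have hvol : volume.real S = ∏ i, 2 * ρ i := by
    rw [measureReal_def, volume_setOf_forall fun i => measurableSet_Icc, ENNReal.toReal_prod]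
    refine Finset.prod_congr rfl fun i _ => ?_
    rw [Real.volume_Icc, ENNReal.toReal_ofReal (by linarith [hρ i])]
    ring
  rw [← setIntegral_eq_integral_of_forall_compl_eq_zero (s := S)
    fun y hy => by rw [hzero y hy]; norm_num]
  calc ∫ y in S, h y ^ 2 ≤ ∫ _y in S, B ^ 2 := by
        refine setIntegral_mono_on ((hh.pow 2).continuousOn.integrableOn_compact hS)
          (integrableOn_const hS.measure_lt_top.ne) hS.measurableSet fun y _ => ?_
        exact sq_le_sq' (abs_le.1 (hB y)).1 (abs_le.1 (hB y)).2
    _ = B ^ 2 * ∏ i, 2 * ρ i := by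
        rw [setIntegral_const, hvol, smul_eq_mul, mul_comm]

/-- The points of a cubic grid of mesh `π δ`. -/
noncomputable def gridPoint {M : ℕ} (δ : ℝ) (j : Fin d → Fin M) : EuclideanSpace ℝ (Fin d) :=
  WithLp.toLp 2 fun i => Real.pi * δ * (j i : ℕ)

lemma gridPoint_apply {M : ℕ} (δ : ℝ) (j : Fin d → Fin M) (i : Fin d) :
    gridPoint δ j i = Real.pi * δ * (j i : ℕ) := rfl

lemma gridPoint_mem_Icc {M : ℕ} {δ : ℝ} (hδ : 0 < δ) (hM : Real.pi * δ * M ≤ 1)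
    (j : Fin d → Fin M) (i : Fin d) : gridPoint δ j i ∈ Set.Icc (0 : ℝ) 1 := by
  have hπ := Real.pi_pos
  rw [gridPoint_apply]
  refine ⟨by positivity, le_trans ?_ hM⟩
  gcongr
  exact (j i).2.le

lemma gridPoint_mem_cube {M : ℕ} {δ : ℝ} (hδ : 0 < δ) (hM : Real.pi * δ * M ≤ 1)
    (j : Fin d → Fin M) : gridPoint δ j ∈ cube d := fun i =>
  ⟨by linarith [(gridPoint_mem_Icc hδ hM j i).1], (gridPoint_mem_Icc hδ hM j i).2⟩

/-- Some coordinate differs by at least πδ ≥ δ, so the bump at one grid point vanishes at all the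
others. -/
lemma one_le_norm_smul_gridPoint_sub {M : ℕ} {δ : ℝ} (hδ : 0 < δ) {i j : Fin d → Fin M}
    (hij : i ≠ j) : 1 ≤ ‖δ⁻¹ • (gridPoint δ j - gridPoint δ i)‖ := by
  obtain ⟨k, hk⟩ := Function.ne_iff.1 hij
  refine le_trans ?_ (PiLp.norm_apply_le (δ⁻¹ • (gridPoint δ j - gridPoint δ i)) k)
  have hne : ((j k : ℕ) : ℤ) - (i k : ℕ) ≠ 0 := by
    rw [sub_ne_zero]; exact fun h => hk (Fin.ext (by exact_mod_cast h.symm))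
  have h1 : (1 : ℝ) ≤ |((j k : ℕ) : ℝ) - (i k : ℕ)| := by
    exact_mod_cast Int.one_le_abs hne
  have e : (δ⁻¹ • (gridPoint δ j - gridPoint δ i)) k
      = Real.pi * (((j k : ℕ) : ℝ) - (i k : ℕ)) := by
    simp only [PiLp.smul_apply, PiLp.sub_apply, gridPoint_apply, smul_eq_mul]
    field_simp
  rw [e, Real.norm_eq_abs, abs_mul, abs_of_pos Real.pi_pos]
  nlinarith [Real.pi_gt_three]

section unitBump

variable {E : Type*} [NormedAddCommGroup E]

/-- The data of `unitBump`. -/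
noncomputable def unitBumpData (E : Type*) [NormedAddCommGroup E] : ContDiffBump (0 : E) where
  rIn := 1 / 4
  rOut := 1 / 2
  rIn_pos := by norm_num
  rIn_lt_rOut := by norm_num

variable [NormedSpace ℝ E] [HasContDiffBump E]

/-- A smooth bump function of height one supported in the ball of radius `1 / 2`. -/
noncomputable def unitBump (x : E) : ℝ := unitBumpData E x

lemma unitBump_nonneg (x : E) : 0 ≤ unitBump x := (unitBumpData E).nonneg

lemma unitBump_le_one (x : E) : unitBump x ≤ 1 := (unitBumpData E).le_one

lemma contDiff_unitBump : ContDiff ℝ ∞ (unitBump (E := E)) := (unitBumpData E).contDiff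

lemma hasCompactSupport_unitBump [FiniteDimensional ℝ E] : HasCompactSupport (unitBump (E := E)) :=
  (unitBumpData E).hasCompactSupport

lemma unitBump_zero : unitBump (0 : E) = 1 :=
  (unitBumpData E).one_of_mem_closedBall (Metric.mem_closedBall_self (unitBumpData E).rIn_pos.le)

lemma unitBump_eq_zero {x : E} (hx : 1 / 2 ≤ ‖x‖) : unitBump x = 0 :=
  (unitBumpData E).zero_of_le_dist (by rw [dist_zero_right]; exact hx)

lemma norm_lt_of_unitBump_ne_zero {x : E} (hx : unitBump x ≠ 0) : ‖x‖ < 1 / 2 := by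
  by_contra! h
  exact hx (unitBump_eq_zero h)

end unitBump

lemma norm_sub_lt_of_unitBump_ne_zero {δ : ℝ} (hδ : 0 < δ) {x y : EuclideanSpace ℝ (Fin d)}
    (h : unitBump (δ⁻¹ • (y - x)) ≠ 0) (i : Fin d) : |y i - x i| < δ / 2 := by
  have h1 := norm_lt_of_unitBump_ne_zero h
  have h2 := PiLp.norm_apply_le (δ⁻¹ • (y - x)) i
  have e : (δ⁻¹ • (y - x)) i = δ⁻¹ * (y i - x i) := rfl
  rw [e, Real.norm_eq_abs, abs_mul, abs_of_pos (by positivity : 0 < δ⁻¹)] at h2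
  have h3 : δ⁻¹ * |y i - x i| < 1 / 2 := h2.trans_lt h1
  rw [inv_mul_lt_iff₀ hδ] at h3
  linarith

/-- Hypotheses `f ∘ G`, with `G` a bump at scale `δ` and `f` a rescaled sine at scale `δ ^ θ`. -/
theorem exists_bump_hypotheses {γ β L₁ L₂ θ : ℝ} (hγ : 0 < γ) (hβ : 0 < β) (hL₁ : 0 < L₁)
    (hL₂ : 0 < L₂) (hθ : 0 ≤ θ) (hθβ : θ ≤ β) :
    ∃ κ > 0, ∃ C > 0, ∀ δ : ℝ, 0 < δ → δ ≤ 1 → ∀ M : ℕ, Real.pi * δ * M ≤ 1 →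
      ∃ (g₀ : EuclideanSpace ℝ (Fin d) → ℝ)
        (g : (Fin d → Fin M) → EuclideanSpace ℝ (Fin d) → ℝ)
        (x : (Fin d → Fin M) → EuclideanSpace ℝ (Fin d)),
        Continuous g₀ ∧ ∀ j, Continuous (g j) ∧ g j ∈ compositeClass d γ β L₁ L₂ ∧ x j ∈ cube d ∧
          2 * (κ * δ ^ (β + θ * (γ - 1))) ≤ |g j (x j) - g₀ (x j)| ∧
          (∀ i, i ≠ j → g i (x j) = g₀ (x j)) ∧ MemLp (g j - g₀) 2 volume ∧
          ∫ y, (g j y - g₀ y) ^ 2 ≤ C * δ ^ (2 * (β + θ * (γ - 1)) + d) := by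
  obtain ⟨c₀, hc₀, hG⟩ := exists_isHolder_rescale (d := d) hβ hL₂
    (ψ := unitBump) contDiff_unitBump hasCompactSupport_unitBump
  let c := min 1 c₀
  have hc : 0 < c := lt_min one_pos hc₀
  have hc1 : c ≤ 1 := min_le_left _ _
  let b := L₁ / (holderOrder γ + 2)
  have hb : 0 < b := by positivity
  have hπ := Real.pi_pos
  refine ⟨b * c / Real.pi, by positivity, (b * c) ^ 2 * 2 ^ d, by positivity,
    fun δ hδ hδ1 M hM => ?_⟩
  set τ := δ ^ θ with hτ
  have hτ0 : 0 < τ := by positivity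
  have hτ1 : τ ≤ 1 := Real.rpow_le_one hδ.le hδ1 hθ
  let f : ℝ → ℝ := fun u => b * τ ^ γ * Real.sin (τ⁻¹ * u)
  let G : (Fin d → Fin M) → EuclideanSpace ℝ (Fin d) → ℝ :=
    fun j y => c * δ ^ β * unitBump (δ⁻¹ • (y - gridPoint δ j))
  have hf : IsHolderReal γ L₁ f :=
    isHolderReal_rescale hγ hτ0 hτ1 zero_le_one hb.le Real.contDiff_sin
      (fun n _ u => Real.abs_iteratedDeriv_sin_le_one n u)
      (by rw [mul_one]; exact (mul_div_cancel₀ _ (by positivity)).le)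
  have hGj : ∀ j, IsHolder d β L₂ (G j) := fun j =>
    hG c hc.le (min_le_right _ _) δ hδ hδ1 (gridPoint δ j)
  have hGc : ∀ j, Continuous (G j) := fun j => (hGj j).contDiff.continuous
  have hfc : Continuous f := by fun_prop
  -- Since θ ≤ β, the sine is evaluated where it is comparable to its argument, and f ∘ G has height
  -- τ^{γ-1} δ^β.
  have hamp : τ ^ γ * (τ⁻¹ * δ ^ β) = δ ^ (β + θ * (γ - 1)) := by
    rw [hτ, ← Real.rpow_neg hδ.le, ← Real.rpow_mul hδ.le, ← Real.rpow_add hδ, ← Real.rpow_add hδ]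
    congr 1; ring
  have hτβ : τ⁻¹ * δ ^ β ≤ 1 := by
    rw [inv_mul_le_iff₀ hτ0, mul_one]
    exact Real.rpow_le_rpow_of_exponent_ge hδ hδ1 hθβ
  refine ⟨0, fun j => f ∘ G j, gridPoint δ, continuous_const, fun j => ⟨hfc.comp (hGc j),
    ⟨f, G j, hf, hGj j, rfl⟩, gridPoint_mem_cube hδ hM j, ?_, fun i hij => ?_, ?_⟩⟩
  · have e : G j (gridPoint δ j) = c * δ ^ β := by simp [G, unitBump_zero]
    have hs : 2 / Real.pi * (τ⁻¹ * (c * δ ^ β)) ≤ Real.sin (τ⁻¹ * (c * δ ^ β)) := by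
      refine Real.mul_le_sin (by positivity) ?_
      have : τ⁻¹ * (c * δ ^ β) = c * (τ⁻¹ * δ ^ β) := by ring
      rw [this]
      nlinarith [Real.pi_gt_three, mul_le_one₀ hc1 (by positivity) hτβ]
    simp only [Function.comp, Pi.zero_apply, sub_zero, e, f]
    refine le_trans ?_ (le_abs_self _)
    rw [← hamp]
    calc _ = b * τ ^ γ * (2 / Real.pi * (τ⁻¹ * (c * δ ^ β))) := by ring
      _ ≤ _ := by gcongr
  · have : G i (gridPoint δ j) = 0 := by
      simp only [G]
      rw [unitBump_eq_zero (by linarith [one_le_norm_smul_gridPoint_sub hδ hij]), mul_zero]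
    simp [Function.comp, this, f]
  · have hB : ∀ y, |(f ∘ G j - 0) y| ≤ b * c * δ ^ (β + θ * (γ - 1)) := by
      intro y
      rw [sub_zero, Function.comp]
      simp only [f, G]
      have h1 : |Real.sin (τ⁻¹ * (c * δ ^ β * unitBump (δ⁻¹ • (y - gridPoint δ j))))|
          ≤ τ⁻¹ * (c * δ ^ β * 1) := by
        refine Real.abs_sin_le_abs.trans ?_
        rw [abs_of_nonneg (mul_nonneg (by positivity) (mul_nonneg (by positivity) (unitBump_nonneg _)))]
        gcongr
        exact unitBump_le_one _
      rw [abs_mul, abs_of_pos (by positivity : 0 < b * τ ^ γ), ← hamp]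
      calc _ ≤ b * τ ^ γ * (τ⁻¹ * (c * δ ^ β * 1)) := by gcongr
        _ = _ := by ring
    have hsupp : ∀ y, (f ∘ G j - 0) y ≠ 0 → ∀ i, |y i - gridPoint δ j i| ≤ δ := by
      intro y hy i
      have : unitBump (δ⁻¹ • (y - gridPoint δ j)) ≠ 0 := by
        rintro h0
        simp [Function.comp, f, G, h0] at hy
      linarith [norm_sub_lt_of_unitBump_ne_zero hδ this i]
    obtain ⟨h1, h2⟩ := memLp_and_integral_sq_le (h := f ∘ G j - 0)
      ((hfc.comp (hGc j)).sub continuous_const) hB (gridPoint δ j) (fun _ => hδ.le) hsupp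
    refine ⟨h1, h2.trans (le_of_eq ?_)⟩
    have hpow : δ ^ (2 * (β + θ * (γ - 1)) + d) = (δ ^ (β + θ * (γ - 1))) ^ 2 * δ ^ d := by
      rw [Real.rpow_add hδ _ (d : ℝ), Real.rpow_natCast, mul_comm 2 (β + _), Real.rpow_mul hδ.le,
        Real.rpow_two]
    rw [Finset.prod_const, Finset.card_univ, Fintype.card_fin, hpow, mul_pow 2 δ]
    ring

/-- The comb `w ↦ K (R sin (w / R))`, a bump near each zero of the sine. -/
noncomputable def comb (R w : ℝ) : ℝ := unitBump (R * Real.sin (R⁻¹ * w))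

lemma contDiff_comb (R : ℝ) : ContDiff ℝ ∞ (comb R) :=
  contDiff_unitBump.comp (contDiff_const.mul (Real.contDiff_sin.comp (contDiff_const.mul contDiff_id)))

lemma comb_nonneg (R w : ℝ) : 0 ≤ comb R w := unitBump_nonneg _

lemma comb_le_one (R w : ℝ) : comb R w ≤ 1 := unitBump_le_one _

/-- Uniform in R: the derivative of order i ≥ 1 of R sin(w/R) is at most R^{1-i} ≤ 1, and the bound
for derivatives of a composition does the rest. -/
lemma exists_abs_iteratedDeriv_comb_le (N : ℕ) :
    ∃ M > 0, ∀ R, 1 ≤ R → ∀ n ≤ N, ∀ w, |iteratedDeriv n (comb R) w| ≤ M := by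
  obtain ⟨K, hK0, hK⟩ := exists_iteratedFDeriv_le_of_hasCompactSupport
    (contDiff_unitBump (E := ℝ)) hasCompactSupport_unitBump N
  refine ⟨N.factorial * K, by positivity, fun R hR n hn w => ?_⟩
  have hR0 : 0 < R := by linarith
  have hinner : ContDiff ℝ ∞ fun w : ℝ => R * Real.sin (R⁻¹ * w) :=
    contDiff_const.mul (Real.contDiff_sin.comp (contDiff_const.mul contDiff_id))
  have key := norm_iteratedFDeriv_comp_le (n := n) (N := ∞) (contDiff_unitBump (E := ℝ)) hinner
    (by exact_mod_cast le_top) w (C := K) (D := 1) (fun i hi => hK i (hi.trans hn) _)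
    (fun i hi _ => by
      rw [norm_iteratedFDeriv_eq_norm_iteratedDeriv, iteratedDeriv_const_mul_field,
        iteratedDeriv_comp_const_mul Real.contDiff_sin, Real.norm_eq_abs, abs_mul R,
        abs_mul (R⁻¹ ^ i), abs_of_pos hR0, abs_of_pos (by positivity : 0 < R⁻¹ ^ i), one_pow]
      have h1 : R * R⁻¹ ^ i ≤ 1 := by
        obtain ⟨k, rfl⟩ := Nat.exists_eq_add_of_le' hi
        rw [pow_succ', ← mul_assoc, mul_inv_cancel₀ hR0.ne', one_mul]
        exact pow_le_one₀ (by positivity) (inv_le_one_of_one_le₀ hR)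
      calc R * (R⁻¹ ^ i * |iteratedDeriv i Real.sin (R⁻¹ * w)|)
          ≤ R * (R⁻¹ ^ i * 1) := by gcongr; exact Real.abs_iteratedDeriv_sin_le_one _ _
        _ ≤ 1 := by rwa [mul_one])
  rw [norm_iteratedFDeriv_eq_norm_iteratedDeriv, Real.norm_eq_abs, one_pow, mul_one] at key
  refine key.trans ?_
  gcongr

lemma comb_nat_mul_pi {R : ℝ} (hR : R ≠ 0) (n : ℕ) : comb R (R * (n * Real.pi)) = 1 := by
  rw [comb, inv_mul_cancel_left₀ hR, Real.sin_nat_mul_pi, mul_zero, unitBump_zero]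

/-- Between the teeth. As 3/2 < π/2, Jordan's inequality gives R |sin(z/R)| ≥ 2|z|/π ≥ 1/2, outside
the support of the bump. -/
lemma comb_eq_zero {R z : ℝ} (hR : 0 < R) (n : ℕ) (hz : 1 ≤ |z|) (hzR : |z| ≤ R * (3 / 2)) :
    comb R (R * (n * Real.pi) + z) = 0 := by
  refine unitBump_eq_zero ?_
  have hπ := Real.pi_gt_three
  have hπ' := Real.pi_lt_four
  have hz' : |R⁻¹ * z| = R⁻¹ * |z| := by rw [abs_mul, abs_of_pos (by positivity : 0 < R⁻¹)]
  have h1 := Real.mul_abs_le_abs_sin (x := R⁻¹ * z) (by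
    rw [hz', inv_mul_le_iff₀ hR]
    exact hzR.trans (by gcongr))
  rw [mul_add, inv_mul_cancel_left₀ hR.ne', add_comm, Real.sin_add_nat_mul_pi, Real.norm_eq_abs,
    abs_mul, abs_mul, abs_pow, abs_neg, abs_one, one_pow, one_mul, abs_of_pos hR]
  rw [hz'] at h1
  calc (1 : ℝ) / 2 ≤ 2 / Real.pi * 1 := by
        rw [mul_one, div_le_div_iff₀ (by norm_num) (by positivity)]; linarith
    _ ≤ 2 / Real.pi * |z| := by gcongr
    _ = R * (2 / Real.pi * (R⁻¹ * |z|)) := by field_simp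
    _ ≤ _ := by gcongr

/-- A smooth compactly supported function which coincides with a coordinate on a large cube. -/
lemma exists_cutoff_coordinate (i₀ : Fin d) :
    ∃ χ : EuclideanSpace ℝ (Fin d) → ℝ, ContDiff ℝ ∞ χ ∧ HasCompactSupport χ ∧
      ∀ y, (∀ i, |y i| ≤ 2) → χ y = y i₀ := by
  -- Points with all |y i| ≤ 2 have norm at most 2√d ≤ 2d + 1.
  let B : ContDiffBump (0 : EuclideanSpace ℝ (Fin d)) :=
    ⟨2 * d + 1, 2 * d + 2, by positivity, by linarith⟩
  have hcoord : ContDiff ℝ ∞ fun y : EuclideanSpace ℝ (Fin d) => y i₀ :=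
    (EuclideanSpace.proj (𝕜 := ℝ) i₀).contDiff
  refine ⟨fun y => B y * y i₀, B.contDiff.mul hcoord, B.hasCompactSupport.mul_right, fun y hy => ?_⟩
  have hn : ‖y‖ ≤ 2 * d + 1 := by
    rw [EuclideanSpace.norm_eq]
    refine Real.sqrt_le_iff.2 ⟨by positivity, ?_⟩
    calc ∑ i, ‖y i‖ ^ 2 ≤ ∑ _i : Fin d, (2 : ℝ) ^ 2 :=
          Finset.sum_le_sum fun i _ => by rw [Real.norm_eq_abs]; gcongr; exact hy i
      _ ≤ (2 * d + 1) ^ 2 := by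
          simp only [Finset.sum_const, Finset.card_univ, Fintype.card_fin, nsmul_eq_mul]
          nlinarith [(Nat.cast_nonneg d : (0 : ℝ) ≤ d)]
  have : B y = 1 := B.one_of_mem_closedBall (by simpa [Metric.mem_closedBall, B] using hn)
  simp [this]

/-- Hypotheses `f ∘ G`, with `f` a comb of bumps of width `δ ^ β` and `G` a coordinate function
perturbed by a bump at scale `δ`. -/
theorem exists_comb_hypotheses (hd : 1 ≤ d) {γ β L₁ L₂ : ℝ} (hγ : 0 < γ) (hβ : 1 < β)
    (hL₁ : 0 < L₁) (hL₂ : 0 < L₂) :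
    ∃ κ > 0, ∃ C > 0, ∀ δ : ℝ, 0 < δ → δ ≤ 1 → ∀ M : ℕ, Real.pi * δ * M ≤ 1 →
      ∃ (g₀ : EuclideanSpace ℝ (Fin d) → ℝ)
        (g : (Fin d → Fin M) → EuclideanSpace ℝ (Fin d) → ℝ)
        (x : (Fin d → Fin M) → EuclideanSpace ℝ (Fin d)),
        Continuous g₀ ∧ ∀ j, Continuous (g j) ∧ g j ∈ compositeClass d γ β L₁ L₂ ∧ x j ∈ cube d ∧
          2 * (κ * δ ^ (γ * β)) ≤ |g j (x j) - g₀ (x j)| ∧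
          (∀ i, i ≠ j → g i (x j) = g₀ (x j)) ∧ MemLp (g j - g₀) 2 volume ∧
          ∫ y, (g j y - g₀ y) ^ 2 ≤ C * δ ^ (2 * γ * β + β + d - 1) := by
  have hβ0 : 0 < β := by linarith
  let i₀ : Fin d := ⟨0, hd⟩
  obtain ⟨χ, hχ, hχc, hχeq⟩ := exists_cutoff_coordinate i₀
  obtain ⟨c₁, hc₁, hψ⟩ := exists_isHolder_rescale (d := d) hβ0 (half_pos hL₂)
    (ψ := unitBump) contDiff_unitBump hasCompactSupport_unitBump
  obtain ⟨c₂, hc₂, hχH⟩ := exists_isHolder_rescale (d := d) hβ0 (half_pos hL₂) hχ hχc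
  obtain ⟨K, hK0, hK⟩ := exists_abs_iteratedDeriv_comb_le (holderOrder γ + 1)
  obtain ⟨c, hc, hc1, hcc₁, hcc₂⟩ : ∃ c > 0, c ≤ 1 ∧ c ≤ c₁ ∧ c ≤ c₂ :=
    ⟨min 1 (min c₁ c₂), by positivity, min_le_left _ _, (min_le_right _ _).trans (min_le_left _ _),
      (min_le_right _ _).trans (min_le_right _ _)⟩
  let b := L₁ / ((holderOrder γ + 2) * K)
  have hb : 0 < b := by positivity
  have hπ := Real.pi_pos
  refine ⟨b * c ^ γ / 2, by positivity, (b * c ^ γ) ^ 2 * (4 * 2 ^ (d - 1)), by positivity,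
    fun δ hδ hδ1 M hM => ?_⟩
  set h := δ ^ β with hh
  have hh0 : 0 < h := by positivity
  have hhδ : h ≤ δ := by
    calc h ≤ δ ^ (1 : ℝ) := Real.rpow_le_rpow_of_exponent_ge hδ hδ1 hβ.le
      _ = δ := Real.rpow_one δ
  have hh1 : h ≤ 1 := hhδ.trans hδ1
  -- In the unscaled coordinate the teeth are πδ apart, the mesh of the grid, and have width of
  -- order h. The hypothesis β > 1 gives R ≥ 1.
  set R := δ / h with hR
  have hR0 : 0 < R := by positivity
  have hR1 : 1 ≤ R := (one_le_div hh0).2 hhδ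
  let f : ℝ → ℝ := fun u => b * (c * h) ^ γ * comb R ((c * h)⁻¹ * u)
  let G₀ : EuclideanSpace ℝ (Fin d) → ℝ := fun y => c * χ y
  let ψ : (Fin d → Fin M) → EuclideanSpace ℝ (Fin d) → ℝ :=
    fun j y => unitBump (δ⁻¹ • (y - gridPoint δ j))
  let G : (Fin d → Fin M) → EuclideanSpace ℝ (Fin d) → ℝ := fun j y => c * χ y + c * h * ψ j y
  have hf : IsHolderReal γ L₁ f :=
    isHolderReal_rescale hγ (by positivity) (mul_le_one₀ hc1 hh0.le hh1) hK0.le hb.le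
      (contDiff_comb R) (hK R hR1) (le_of_eq (by simp only [b]; field_simp))
  have hψc : ∀ j, ContDiff ℝ ∞ (ψ j) := fun j =>
    contDiff_unitBump.comp ((contDiff_id.sub contDiff_const).const_smul _)
  have hG : ∀ j, IsHolder d β L₂ (G j) := by
    intro j
    have h1 := hψ c hc.le hcc₁ δ hδ hδ1 (gridPoint δ j)
    have h2 := hχH c hc.le hcc₂ 1 one_pos le_rfl 0
    simp only [Real.one_rpow, mul_one, inv_one, one_smul, sub_zero] at h2
    have h3 := IsHolder.add (half_pos hL₂).le (half_pos hL₂).le (contDiff_const.mul hχ)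
      (contDiff_const.mul (hψc j)) h2 h1
    rwa [add_halves] at h3
  have hGc : ∀ j, Continuous (G j) := fun j => (hG j).contDiff.continuous
  have hG₀c : Continuous G₀ := continuous_const.mul hχ.continuous
  have hfc : Continuous f := hf.contDiff.continuous
  have hgrid : ∀ (j : Fin d → Fin M) (i : Fin d), |gridPoint δ j i| ≤ 1 := fun j i =>
    abs_le.2 ⟨by linarith [(gridPoint_mem_Icc hδ hM j i).1], (gridPoint_mem_Icc hδ hM j i).2⟩
  have hfval : ∀ (j : Fin d → Fin M) (t : ℝ), f (c * (gridPoint δ j i₀ + t))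
      = b * (c * h) ^ γ * comb R (R * ((j i₀ : ℕ) * Real.pi) + h⁻¹ * t) := by
    intro j t
    simp only [f, gridPoint_apply]
    congr 2
    rw [hR]
    field_simp
  have hamp : (c * h) ^ γ = c ^ γ * δ ^ (γ * β) := by
    rw [Real.mul_rpow hc.le hh0.le, hh, ← Real.rpow_mul hδ.le, mul_comm β]
  refine ⟨f ∘ G₀, fun j => f ∘ G j, gridPoint δ, hfc.comp hG₀c, fun j => ⟨hfc.comp (hGc j),
    ⟨f, G j, hf, hG j, rfl⟩, gridPoint_mem_cube hδ hM j, ?_, fun i hij => ?_, ?_⟩⟩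
  · have hχj := hχeq (gridPoint δ j) fun i => (hgrid j i).trans (by norm_num)
    have e0 : (f ∘ G₀) (gridPoint δ j) = b * (c * h) ^ γ := by
      have h1 := hfval j 0
      rw [add_zero, mul_zero, add_zero, comb_nat_mul_pi hR0.ne', mul_one] at h1
      simp only [Function.comp, G₀, hχj, h1]
    -- The bump moves the comb variable by exactly 1, from the top of a tooth to a zero.
    have e1 : (f ∘ G j) (gridPoint δ j) = 0 := by
      have h1 := hfval j h
      rw [inv_mul_cancel₀ hh0.ne', comb_eq_zero hR0 _ (by simp) (by rw [abs_one]; linarith),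
        mul_zero] at h1
      rw [← h1]
      simp only [Function.comp, G, ψ, hχj, sub_self, smul_zero, unitBump_zero]
      ring_nf
    change _ ≤ |(f ∘ G j) (gridPoint δ j) - (f ∘ G₀) (gridPoint δ j)|
    rw [e0, e1, zero_sub, abs_neg, abs_of_pos (by positivity), hamp]
    exact le_of_eq (by ring)
  · have : G i (gridPoint δ j) = G₀ (gridPoint δ j) := by
      simp only [G, G₀, ψ]
      rw [unitBump_eq_zero (by linarith [one_le_norm_smul_gridPoint_sub hδ hij]), mul_zero, add_zero]
    simp only [Function.comp, this]
  · have hB : ∀ y, |(f ∘ G j - f ∘ G₀) y| ≤ b * (c * h) ^ γ := by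
      intro y
      have h0 : ∀ u, 0 ≤ f u := fun u => mul_nonneg (by positivity) (comb_nonneg _ _)
      have h1 : ∀ u, f u ≤ b * (c * h) ^ γ := fun u =>
        mul_le_of_le_one_right (by positivity) (comb_le_one _ _)
      simp only [Pi.sub_apply, Function.comp]
      exact abs_sub_le_iff.2 ⟨by linarith [h0 (G₀ y), h1 (G j y)], by linarith [h1 (G₀ y), h0 (G j y)]⟩
    -- Along the coordinate carried by G₀ the difference survives only near the tooth: width h, plus
    -- a displacement of at most h. Elsewhere the bump gives δ.
    let ρ : Fin d → ℝ := fun i => if i = i₀ then 2 * h else δ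
    have hsupp : ∀ y, (f ∘ G j - f ∘ G₀) y ≠ 0 → ∀ i, |y i - gridPoint δ j i| ≤ ρ i := by
      intro y hy i
      have hψy : unitBump (δ⁻¹ • (y - gridPoint δ j)) ≠ 0 := by
        rintro h0
        simp [Function.comp, G, G₀, ψ, h0] at hy
      have hclose := norm_sub_lt_of_unitBump_ne_zero hδ hψy
      simp only [ρ]
      split_ifs with hi
      · subst hi
        by_contra! hfar
        apply hy
        have hχy := hχeq y fun i => by
          have h1 := abs_add_le (y i - gridPoint δ j i) (gridPoint δ j i)
          rw [sub_add_cancel] at h1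
          linarith [hclose i, hgrid j i]
        -- If y is more than 2h away from the tooth, then y + t is at distance between h and δ/2 + h
        -- ≤ 3δ/2, the range of `comb_eq_zero`. This covers both the original and the displaced
        -- value.
        have hvanish : ∀ t, 0 ≤ t → t ≤ h → f (c * (y i₀ + t)) = 0 := by
          intro t ht0 ht
          have e : y i₀ + t = gridPoint δ j i₀ + (y i₀ - gridPoint δ j i₀ + t) := by ring
          have hz : |h⁻¹ * (y i₀ - gridPoint δ j i₀ + t)|
              = |y i₀ - gridPoint δ j i₀ + t| / h := by
            rw [abs_mul, abs_of_pos (by positivity : 0 < h⁻¹), inv_mul_eq_div]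
          have hle := abs_add_le (y i₀ - gridPoint δ j i₀) t
          have hge := abs_sub_abs_le_abs_add (y i₀ - gridPoint δ j i₀) t
          rw [abs_of_nonneg ht0] at hle hge
          rw [e, hfval, comb_eq_zero hR0, mul_zero]
          · rw [hz, le_div_iff₀ hh0]; linarith
          · rw [hz, hR, div_mul_eq_mul_div]
            gcongr
            linarith [hclose i₀]
        have v0 := hvanish 0 le_rfl hh0.le
        have v1 := hvanish (h * ψ j y) (mul_nonneg hh0.le (unitBump_nonneg _))
          (mul_le_of_le_one_right hh0.le (unitBump_le_one _))
        rw [add_zero] at v0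
        rw [mul_add, ← mul_assoc] at v1
        simp only [Pi.sub_apply, Function.comp, G, G₀, hχy, v0, v1, sub_zero]
      · linarith [hclose i]
    obtain ⟨h1, h2⟩ := memLp_and_integral_sq_le (h := f ∘ G j - f ∘ G₀)
      ((hfc.comp (hGc j)).sub (hfc.comp hG₀c)) hB (gridPoint δ j)
      (ρ := ρ) (fun i => by simp only [ρ]; split_ifs <;> positivity) hsupp
    refine ⟨h1, h2.trans (le_of_eq ?_)⟩
    have hprod : ∏ i, 2 * ρ i = 4 * h * (2 * δ) ^ (d - 1) := by
      rw [← Finset.mul_prod_erase _ _ (Finset.mem_univ i₀)]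
      have : ∏ i ∈ Finset.univ.erase i₀, 2 * ρ i = ∏ _i ∈ Finset.univ.erase i₀, 2 * δ :=
        Finset.prod_congr rfl fun i hi => by simp only [ρ, if_neg (Finset.ne_of_mem_erase hi)]
      rw [this, Finset.prod_const, Finset.card_erase_of_mem (Finset.mem_univ _), Finset.card_univ,
        Fintype.card_fin]
      simp only [ρ, if_true]
      ring
    have hpow : δ ^ (2 * γ * β + β + d - 1) = (δ ^ (γ * β)) ^ 2 * h * δ ^ (d - 1) := by
      have e : 2 * γ * β + β + d - 1 = γ * β * (2 : ℕ) + β + ((d - 1 : ℕ) : ℝ) := by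
        push_cast [hd]; ring
      rw [e, Real.rpow_add hδ, Real.rpow_add hδ, Real.rpow_mul hδ.le, Real.rpow_natCast,
        Real.rpow_natCast]
    rw [hprod, hamp, hpow, mul_pow 2 δ]
    ring

end Construction

end CompositeEstimation

theorem theorem1 {d : ℕ} (hd : 1 ≤ d)
    (a b : Fin d → ℝ) (ha : ∀ i, a i < -1) (hb : ∀ i, 1 < b i)
    {Ω : Type*} [MeasurableSpace Ω] (P : MeasureTheory.Measure Ω)
    [MeasureTheory.IsProbabilityMeasure P]
    (W : EuclideanSpace ℝ (Fin d) → Ω → ℝ)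
    (hW : CompositeEstimation.IsBrownianSheet W P)
    (γ β L₁ L₂ : ℝ) (hγ : 0 < γ) (hβ : 0 < β) (hL₁ : 0 < L₁) (hL₂ : 0 < L₂)
    (p : ℝ) (hp : 0 < p) :
    0 < Filter.liminf
      (fun ε : ℝ => CompositeEstimation.minimaxSupRisk W P (CompositeEstimation.openBox a b)
        (CompositeEstimation.compositeClass d γ β L₁ L₂) p
        (CompositeEstimation.rate d γ β ε) ε)
      (𝓝[>] (0 : ℝ)) := by
  have hd' : (1 : ℝ) ≤ d := by exact_mod_cast hd
  by_cases h1 : 1 < β ∧ d * (γ - 1) + 1 ≤ β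
  · obtain ⟨κ, hκ, C, hC, hyp⟩ :=
      CompositeEstimation.exists_comb_hypotheses hd hγ h1.1 hL₁ hL₂
    have hγβ : 0 < γ * β := by positivity
    have hv : 0 < 2 * γ * β + β + d - 1 := by linarith
    refine CompositeEstimation.liminf_minimaxSupRisk_pos hd hW _ hp hv hκ hC one_pos
      (fun ε => ?_) hyp
    rw [CompositeEstimation.rate, if_pos h1]
    congr 1
    have : 2 * γ + 1 + (d - 1) / β = (2 * γ * β + β + d - 1) / β := by field_simp; ring
    rw [this]
    field_simp
  by_cases h2 : 1 < γ ∧ β < d * (γ - 1) + 1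
  -- With θ = 0 the link f is a fixed sine, so the difficulty is that of estimating G: a = β and v =
  -- 2β + d.
  · obtain ⟨κ, hκ, C, hC, hyp⟩ := CompositeEstimation.exists_bump_hypotheses (d := d) (θ := 0)
      hγ hβ hL₁ hL₂ le_rfl hβ.le
    refine CompositeEstimation.liminf_minimaxSupRisk_pos hd hW _ hp (by nlinarith) hκ hC one_pos
      (fun ε => ?_) hyp
    rw [CompositeEstimation.rate, if_neg h1, if_pos h2]
    congr 1
    rw [zero_mul, add_zero]
    field_simp
  -- With θ = β the sine oscillates at the scale of the height of G: a = γβ and v = 2γβ + d, as for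
  -- smoothness γβ.
  · obtain ⟨κ, hκ, C, hC, hyp⟩ := CompositeEstimation.exists_bump_hypotheses (d := d) (θ := β)
      hγ hβ hL₁ hL₂ hβ.le le_rfl
    have e : β + β * (γ - 1) = γ * β := by ring
    simp only [e] at hyp
    have hγβ : 0 < γ * β := by positivity
    refine CompositeEstimation.liminf_minimaxSupRisk_pos hd hW _ hp (by linarith) hκ hC one_pos
      (fun ε => ?_) hyp
    rw [CompositeEstimation.rate, if_neg h1, if_neg h2]
    congr 1
    field_simp
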